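/- Let $(\Omega,\mathcal F,\mathbb P)$ be an atomless probability space, and let $\Psi:[0,\infty)\to[0,\infty)$ be a finite Young function, i.e. a continuous, nondecreasing, convex function with $\Psi(0)=0$ and $\lim_{x\to\infty}\Psi(x)=\infty$. The Orlicz heart $H^\Psi$ is the vector space of all real random variables $X$ (modulo almost sure equality) with $\mathbb E[\Psi(c|X|)]<\infty$ for all $c>0$. A law-invariant convex risk measure on $H^\Psi$ is a map $\rho:H^\Psi\to\mathbb R$ such that (i) $\rho(X)\ge\rho(Y)$ whenever $X\le Y$ a.s., (ii) $\rho(\lambda X+(1-\lambda)Y)\le\lambda\rho(X)+(1-\lambda)\rho(Y)$ for $\lambda\in[0,1]$, and (iii) $\rho(X)=\rho(Y)$ whenever $X$ and $Y$ have the same law. Let $\mathcal M(H^\Psi)$ be the set of laws of elements of $H^\Psi$. The risk functional of $\rho$ is the map $\mathcal R_\rho:\mathcal M(H^\Psi)\to\mathbb R$ with $\mathcal R_\rho(\mathbb P\circ X^{-1})=\rho(X)$ for all $X\in H^\Psi$. Put $\psi:=\Psi(|\cdot|)$ on $\mathbb R$, and let $\mathcal M_1^\psi$ be the set of Borel probability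 measures $\mu$ on $\mathbb R$ with $\int\psi\,d\mu<\infty$. The $\psi$-weak topology on $\mathcal M_1^\psi$ is the coarsest topology for which $\mu\mapsto\int f\,d\mu$ is continuous for every continuous $f:\mathbb R\to\mathbb R$ with $\sup_x|f(x)|/(1+\psi(x))<\infty$; the set $\mathcal M(H^\Psi)\subseteq\mathcal M_1^\psi$ carries the relative topology. (a) The following two conditions are equivalent: (1) for every law-invariant convex risk measure $\rho$ on $H^\Psi$, the map $\mathcal R_\rho:\mathcal M(H^\Psi)\to\mathbb R$ is continuous for the $\psi$-weak topology; (2) $\Psi$ satisfies the $\Delta_2$-condition: there are $C,x_0>0$ such that $\Psi(2x)\le C\,\Psi(x)$ for all $x\ge x_0$. (b) Suppose that $\Psi$ does not satisfy the $\Delta_2$-condition. Then for every $x_0>0$ the utility-based shortfall risk measure with loss function $x\mapsto\Psi(8x^+)$, $$\rho(X):=\inf\{m\in\mathbb R:\ \mathbb E[\Psi(8(-X-m)^+)]\le x_0\},\qquad X\in H^\Psi,$$ is well defined (the set on the right is non-empty and bounded below for every $X\in H^\Psi$), it is a law-invariant convex risk measure on $H^\Psi$, and its risk functional $\mathcal R_\rho:\mathcal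 M(H^\Psi)\to\mathbb R$ is not continuous for the $\psi$-weak topology. -/

import Mathlib

open MeasureTheory Set Filter Topology
open scoped NNReal ENNReal

/-- A finite Young function: a continuous nondecreasing convex function `Ψ : [0,∞) → [0,∞)` with
`Ψ 0 = 0` and `Ψ x → ∞` as `x → ∞`. -/
structure FiniteYoungFunction where
  toFun : ℝ≥0 → ℝ≥0
  continuous' : Continuous toFun
  monotone' : Monotone toFun
  convex' : ConvexOn ℝ≥0 univ toFun
  map_zero' : toFun 0 = 0
  tendsto_atTop' : Tendsto toFun atTop atTop

instance : CoeFun FiniteYoungFunction (fun _ => ℝ≥0 → ℝ≥0) := ⟨FiniteYoungFunction.toFun⟩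

/-- The `Δ₂`-condition: there are `C, x₀ > 0` with `Ψ (2x) ≤ C Ψ x` for all `x ≥ x₀`. -/
def FiniteYoungFunction.Delta2 (Ψ : FiniteYoungFunction) : Prop :=
  ∃ C x₀ : ℝ≥0, 0 < C ∧ 0 < x₀ ∧ ∀ x, x₀ ≤ x → Ψ (2 * x) ≤ C * Ψ x

/-- A measure is atomless if every measurable set of positive measure has a measurable subset of
positive, strictly smaller measure. -/
def IsAtomless {Ω : Type*} [MeasurableSpace Ω] (P : Measure Ω) : Prop :=
  ∀ s, MeasurableSet s → 0 < P s → ∃ t ⊆ s, MeasurableSet t ∧ 0 < P t ∧ P t < P s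

/-- The Orlicz heart `H^Ψ`: the (classes of a.s. equal) real random variables `X` with
`E[Ψ(c|X|)] < ∞` for all `c > 0`. -/
def orliczHeart {Ω : Type*} [MeasurableSpace Ω] (Ψ : FiniteYoungFunction) (P : Measure Ω) :
    Submodule ℝ (Ω →ₘ[P] ℝ) where
  carrier := {X | ∀ c : ℝ≥0, 0 < c → ∫⁻ ω, (Ψ (c * ‖X ω‖₊) : ℝ≥0∞) ∂P < ∞}
  zero_mem' := by
    intro c _
    have h : (fun ω => (Ψ (c * ‖(0 : Ω →ₘ[P] ℝ) ω‖₊) : ℝ≥0∞)) =ᵐ[P] fun _ => 0 := by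
      filter_upwards [AEEqFun.coeFn_zero (μ := P) (α := Ω) (β := ℝ)] with ω hω
      simp [hω, Ψ.map_zero']
    rw [lintegral_congr_ae h]
    simp
  add_mem' := by
    intro X Y hX hY c hc
    have hm : AEMeasurable (fun ω => (Ψ (2 * c * ‖X ω‖₊) : ℝ≥0∞)) P :=
      (Ψ.continuous'.measurable.comp
        (X.measurable.nnnorm.const_mul _)).coe_nnreal_ennreal.aemeasurable
    refine lt_of_le_of_lt (lintegral_mono_ae (g := fun ω =>
      (Ψ (2 * c * ‖X ω‖₊) : ℝ≥0∞) + (Ψ (2 * c * ‖Y ω‖₊) : ℝ≥0∞)) ?_) ?_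
    · filter_upwards [AEEqFun.coeFn_add X Y] with ω hω
      rw [hω, Pi.add_apply, ← ENNReal.coe_add, ENNReal.coe_le_coe]
      have h1 := nnnorm_add_le (X ω) (Y ω)
      rcases le_total ‖X ω‖₊ ‖Y ω‖₊ with h | h
      · refine le_trans (Ψ.monotone' ?_) le_add_self
        calc c * ‖X ω + Y ω‖₊ ≤ c * (‖Y ω‖₊ + ‖Y ω‖₊) := by gcongr; exact h1.trans (by gcongr)
          _ = 2 * c * ‖Y ω‖₊ := by ring
      · refine le_trans (Ψ.monotone' ?_) le_self_add
        calc c * ‖X ω + Y ω‖₊ ≤ c * (‖X ω‖₊ + ‖X ω‖₊) := by gcongr; exact h1.trans (by gcongr)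
          _ = 2 * c * ‖X ω‖₊ := by ring
    · rw [lintegral_add_left' hm]
      exact ENNReal.add_lt_top.2 ⟨hX _ (by positivity), hY _ (by positivity)⟩
  smul_mem' := by
    intro a X hX c hc
    have h : (fun ω => (Ψ (c * ‖(a • X : Ω →ₘ[P] ℝ) ω‖₊) : ℝ≥0∞)) =ᵐ[P]
        fun ω => (Ψ (c * ‖a‖₊ * ‖X ω‖₊) : ℝ≥0∞) := by
      filter_upwards [AEEqFun.coeFn_smul a X] with ω hω
      rw [hω, Pi.smul_apply, smul_eq_mul, nnnorm_mul, mul_assoc]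
    rw [lintegral_congr_ae h]
    rcases eq_or_ne a 0 with rfl | ha
    · simp [Ψ.map_zero']
    · exact hX _ (mul_pos hc (nnnorm_pos.2 ha))

/-- The law `P ∘ X⁻¹` of a real random variable. -/
noncomputable def rvLaw {Ω : Type*} [MeasurableSpace Ω] {P : Measure Ω} [IsProbabilityMeasure P]
    (X : Ω →ₘ[P] ℝ) : ProbabilityMeasure ℝ :=
  ⟨P.map X, Measure.isProbabilityMeasure_map X.measurable.aemeasurable⟩

/-- Law-invariant convex risk measures on the Orlicz heart (not necessarily cash additive). -/
structure IsLawInvariantConvexRiskMeasure {Ω : Type*} [MeasurableSpace Ω]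
    {Ψ : FiniteYoungFunction} {P : Measure Ω} [IsProbabilityMeasure P]
    (ρ : orliczHeart Ψ P → ℝ) : Prop where
  antitone : ∀ X Y : orliczHeart Ψ P,
    (∀ᵐ ω ∂P, (X : Ω →ₘ[P] ℝ) ω ≤ (Y : Ω →ₘ[P] ℝ) ω) → ρ Y ≤ ρ X
  convex : ConvexOn ℝ univ ρ
  law_invariant : ∀ X Y : orliczHeart Ψ P, rvLaw (X : Ω →ₘ[P] ℝ) = rvLaw (Y : Ω →ₘ[P] ℝ) → ρ X = ρ Y

/-- `M(H^Ψ)`: the set of laws of the elements of `H^Ψ`. -/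
def heartLaws {Ω : Type*} [MeasurableSpace Ω] (Ψ : FiniteYoungFunction) (P : Measure Ω)
    [IsProbabilityMeasure P] : Set (ProbabilityMeasure ℝ) :=
  range fun X : orliczHeart Ψ P => rvLaw (X : Ω →ₘ[P] ℝ)

/-- The risk functional `R_ρ : M(H^Ψ) → ℝ` of `ρ`: its value at `μ` is the value of `ρ` at some
`X ∈ H^Ψ` with law `μ`. For law-invariant `ρ` the choice of `X` is immaterial. -/
noncomputable def riskFunctional {Ω : Type*} [MeasurableSpace Ω] {Ψ : FiniteYoungFunction}
    {P : Measure Ω} [IsProbabilityMeasure P] (ρ : orliczHeart Ψ P → ℝ) (μ : heartLaws Ψ P) : ℝ :=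
  ρ μ.2.choose

theorem riskFunctional_law {Ω : Type*} [MeasurableSpace Ω] {Ψ : FiniteYoungFunction}
    {P : Measure Ω} [IsProbabilityMeasure P] {ρ : orliczHeart Ψ P → ℝ}
    (hρ : IsLawInvariantConvexRiskMeasure ρ) (X : orliczHeart Ψ P) :
    riskFunctional ρ ⟨rvLaw (X : Ω →ₘ[P] ℝ), X, rfl⟩ = ρ X :=
  hρ.law_invariant _ _ (Exists.choose_spec (p := fun Y : orliczHeart Ψ P =>
    rvLaw (Y : Ω →ₘ[P] ℝ) = rvLaw (X : Ω →ₘ[P] ℝ)) ⟨X, rfl⟩)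

/-- `M₁^ψ`: the Borel probability measures `μ` on `ℝ` with `∫ ψ dμ < ∞`. -/
def gaugedMeasures (ψ : ℝ → ℝ≥0) : Set (ProbabilityMeasure ℝ) :=
  {μ | ∫⁻ x, (ψ x : ℝ≥0∞) ∂(μ : Measure ℝ) < ∞}

/-- `C_ψ`: the continuous `f : ℝ → ℝ` for which `|f / (1 + ψ)|` is bounded. -/
def gaugedFunctions (ψ : ℝ → ℝ≥0) : Set (ℝ → ℝ) :=
  {f | Continuous f ∧ ∃ C : ℝ, ∀ x, |f x / (1 + ψ x)| ≤ C}

/-- The `ψ`-weak topology on `M₁^ψ`: the coarsest topology for which `μ ↦ ∫ f dμ` is continuous for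
every `f ∈ C_ψ`. -/
@[reducible] noncomputable def gaugedTopology (ψ : ℝ → ℝ≥0) : TopologicalSpace (gaugedMeasures ψ) :=
  ⨅ f ∈ gaugedFunctions ψ, TopologicalSpace.induced
    (fun μ : gaugedMeasures ψ => ∫ x, f x ∂((μ : ProbabilityMeasure ℝ) : Measure ℝ)) inferInstance

/-- The gauge function `ψ = Ψ(|·|)` on `ℝ`. -/
def FiniteYoungFunction.gauge (Ψ : FiniteYoungFunction) (x : ℝ) : ℝ≥0 := Ψ ‖x‖₊

theorem heartLaws_subset {Ω : Type*} [MeasurableSpace Ω] (Ψ : FiniteYoungFunction)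
    (P : Measure Ω) [IsProbabilityMeasure P] : heartLaws Ψ P ⊆ gaugedMeasures Ψ.gauge := by
  rintro _ ⟨X, rfl⟩
  have hm : Measurable fun x : ℝ => (Ψ ‖x‖₊ : ℝ≥0∞) :=
    (Ψ.continuous'.measurable.comp measurable_nnnorm).coe_nnreal_ennreal
  have h := X.2 1 one_pos
  simp only [one_mul] at h
  change ∫⁻ x, (Ψ ‖x‖₊ : ℝ≥0∞) ∂(P.map (X : Ω →ₘ[P] ℝ)) < ∞
  rwa [lintegral_map hm (X : Ω →ₘ[P] ℝ).measurable]

/-- The relative `ψ`-weak topology, `ψ = Ψ(|·|)`, on `M(H^Ψ) ⊆ M₁^ψ`. -/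
@[reducible] noncomputable def heartLawsTopology {Ω : Type*} [MeasurableSpace Ω] (Ψ : FiniteYoungFunction)
    (P : Measure Ω) [IsProbabilityMeasure P] : TopologicalSpace (heartLaws Ψ P) :=
  TopologicalSpace.induced (inclusion (heartLaws_subset Ψ P)) (gaugedTopology Ψ.gauge)

/-- The cash amounts `m` that make the position `X` acceptable: `E[ℓ(-X - m)] ≤ x₀`. -/
def acceptableCash {Ω : Type*} [MeasurableSpace Ω] {P : Measure Ω}
    (ℓ : ℝ → ℝ≥0) (x₀ : ℝ≥0) (X : Ω →ₘ[P] ℝ) : Set ℝ :=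
  {m | ∫⁻ ω, (ℓ (-X ω - m) : ℝ≥0∞) ∂P ≤ x₀}

/-- The utility-based shortfall risk measure on `H^Ψ` with loss function `ℓ` and threshold `x₀`. -/
noncomputable def shortfallRisk {Ω : Type*} [MeasurableSpace Ω] (Ψ : FiniteYoungFunction)
    (P : Measure Ω) (ℓ : ℝ → ℝ≥0) (x₀ : ℝ≥0) (X : orliczHeart Ψ P) : ℝ :=
  sInf (acceptableCash ℓ x₀ (X : Ω →ₘ[P] ℝ))

/-- The loss function `x ↦ Ψ(a x⁺)` on `ℝ`. -/
noncomputable def FiniteYoungFunction.loss (Ψ : FiniteYoungFunction) (a : ℝ≥0) (x : ℝ) : ℝ≥0 :=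
  Ψ (a * x.toNNReal)

/-! Suppose `Δ₂` holds. It suffices to treat sequences of laws that converge weakly together with
their `Ψ`-moments. An atomless space carries a uniform variable `U`, and composing the quantile
functions with `U` realises all laws on this one space, where weak convergence becomes almost sure
convergence (`ae_tendsto_quantile`). By `Δ₂`, `Ψ(c|f n - F|)` is bounded by an affine function of
`Ψ|f n| + Ψ|F|`, whose integrals converge, so a dominated convergence argument gives `E[Ψ(c|f n -
F|)] → 0` for every `c` (`Delta2.tendsto_modular`). Monotonicity and convexity make every risk
measure on the heart continuous for this convergence (`IsLawInvariantConvexRiskMeasure.tendsto`): a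
fast subsequence of the differences is dominated by `Z / (k + 1)` with a single `Z` in the heart.

Suppose `Δ₂` fails. Then there are points `a n` with `Ψ (a n) ≥ n + 1` and `Ψ (2 * a n) > (n + 1) *
Ψ (a n)`. Let `X n` equal `-a n` with probability about `2 * x₀ / Ψ (8 * a n)` and `0` otherwise.
The moments `E[Ψ|X n|]` tend to `0`, so the laws tend to the law of `0`; but at zero cash the
expected loss of `X n` is eventually `2 * x₀`, so its shortfall risk is nonnegative, while the risk
of `0` is negative. This gives (b), and with it the remaining implication of (a). -/

/-! ### Uniform random variables on atomless spaces -/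

/-- A family of measurable sets that is totally ordered by almost sure inclusion, and contains every
measurable set that is comparable with all its members. -/
structure IsSaturatedAEChain {Ω : Type*} [MeasurableSpace Ω] (P : Measure Ω)
    (C : Set (Set Ω)) : Prop where
  measurableSet : ∀ A ∈ C, MeasurableSet A
  total : ∀ A ∈ C, ∀ B ∈ C, A ≤ᵐ[P] B ∨ B ≤ᵐ[P] A
  saturated : ∀ B, MeasurableSet B → (∀ D ∈ C, D ≤ᵐ[P] B ∨ B ≤ᵐ[P] D) → B ∈ C

/-- Hausdorff's maximality principle: adding to a maximal chain a set comparable with all members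
leaves a chain, so the set was already there. -/
theorem exists_isSaturatedAEChain {Ω : Type*} [MeasurableSpace Ω] (P : Measure Ω) :
    ∃ C, IsSaturatedAEChain P C := by
  let r : {A : Set Ω // MeasurableSet A} → {A : Set Ω // MeasurableSet A} → Prop :=
    fun A B => A.1 ≤ᵐ[P] B.1
  have hmax : IsMaxChain r (maxChain r) := maxChain_spec
  refine ⟨Subtype.val '' maxChain r, ?_, ?_, ?_⟩
  · rintro _ ⟨A, -, rfl⟩
    exact A.2
  · rintro _ ⟨A, hA, rfl⟩ _ ⟨B, hB, rfl⟩
    by_cases h : A = B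
    · subst h
      exact Or.inl (EventuallyLE.refl _ _)
    · exact hmax.1 hA hB h
  · intro B hB h
    have h1 : IsChain r (insert ⟨B, hB⟩ (maxChain r)) :=
      hmax.1.insert fun D hD _ => (h D.1 ⟨D, hD, rfl⟩).symm
    have h2 := hmax.2 h1 (subset_insert _ _)
    exact ⟨⟨B, hB⟩, h2 ▸ mem_insert _ _, rfl⟩

namespace IsSaturatedAEChain

variable {Ω : Type*} [MeasurableSpace Ω] {P : Measure Ω} {C : Set (Set Ω)}

theorem compl (hC : IsSaturatedAEChain P C) : IsSaturatedAEChain P (compl '' C) where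
  measurableSet := by
    rintro _ ⟨A, hA, rfl⟩
    exact (hC.measurableSet A hA).compl
  total := by
    rintro _ ⟨A, hA, rfl⟩ _ ⟨B, hB, rfl⟩
    exact (hC.total A hA B hB).symm.imp EventuallyLE.compl EventuallyLE.compl
  saturated := by
    intro B hB h
    refine ⟨Bᶜ, hC.saturated _ hB.compl fun D hD => ?_, compl_compl B⟩
    refine (h Dᶜ ⟨D, hD, rfl⟩).symm.imp (fun h => ?_) (fun h => ?_)
    · simpa using h.compl
    · simpa using h.compl

theorem ae_le_of_measure_le [IsFiniteMeasure P] (hC : IsSaturatedAEChain P C) {A B : Set Ω}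
    (hA : A ∈ C) (hB : B ∈ C) (h : P A ≤ P B) : A ≤ᵐ[P] B := by
  rcases hC.total A hA B hB with h1 | h1
  · exact h1
  · exact (ae_eq_of_ae_subset_of_measure_ge h1 h (hC.measurableSet B hB).nullMeasurableSet
      (measure_ne_top _ _)).symm.le

/-- The union of members whose measures increase to the supremum is comparable with every member: a
member is either below one of the sets or above all of them. Saturation therefore puts the union
into the chain. -/
theorem exists_max [IsFiniteMeasure P] (hC : IsSaturatedAEChain P C) (t : ℝ≥0∞) :
    ∃ A ∈ C, P A ≤ t ∧ ∀ D ∈ C, P D ≤ t → P D ≤ P A := by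
  have hempty : (∅ : Set Ω) ∈ C := hC.saturated ∅ MeasurableSet.empty fun D _ =>
    Or.inr (LE.le.eventuallyLE (empty_subset D))
  have hne : (P '' {A | A ∈ C ∧ P A ≤ t}).Nonempty := ⟨_, ∅, ⟨hempty, by simp⟩, rfl⟩
  obtain ⟨u, hu, hlim, hmem⟩ := exists_seq_tendsto_sSup hne (OrderTop.bddAbove _)
  choose A hA hAu using hmem
  have hmono : ∀ n, accumulate A n ≤ᵐ[P] A n := by
    intro n
    induction n with
    | zero => simpa [accumulate] using EventuallyLE.refl (ae P) (A 0)
    | succ n ih =>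
      rw [accumulate_succ]
      have h1 : A n ≤ᵐ[P] A (n + 1) := hC.ae_le_of_measure_le (hA n).1 (hA (n + 1)).1 (by
        rw [hAu, hAu]; exact hu n.le_succ)
      have h2 := (ih.trans h1).union (EventuallyLE.refl (ae P) (A (n + 1)))
      rwa [union_self] at h2
  have hle : P (⋃ n, A n) ≤ t := by
    rw [measure_iUnion_eq_iSup_accumulate]
    exact iSup_le fun n => (measure_mono_ae (hmono n)).trans (hA n).2
  have hU : (⋃ n, A n) ∈ C := by
    refine hC.saturated _ (MeasurableSet.iUnion fun n => hC.measurableSet _ (hA n).1) fun D hD => ?_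
    by_cases h : ∃ n, D ≤ᵐ[P] A n
    · obtain ⟨n, hn⟩ := h
      exact Or.inl (hn.trans (LE.le.eventuallyLE (subset_iUnion A n)))
    · push Not at h
      right
      have h2 : ∀ n, A n ≤ᵐ[P] D := fun n => (hC.total D hD _ (hA n).1).resolve_left (h n)
      have h3 := Filter.EventuallyLE.countable_iUnion h2
      rwa [iUnion_const] at h3
  refine ⟨_, hU, hle, fun D hD hDt => ?_⟩
  refine (le_sSup ⟨D, ⟨hD, hDt⟩, rfl⟩ : P D ≤ sSup (P '' {A | A ∈ C ∧ P A ≤ t})).trans ?_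
  refine le_of_tendsto hlim (Eventually.of_forall fun n => ?_)
  rw [← hAu]
  exact measure_mono (subset_iUnion A n)

theorem exists_min [IsFiniteMeasure P] (hC : IsSaturatedAEChain P C) {t : ℝ≥0∞}
    (ht : t ≤ P univ) : ∃ B ∈ C, t ≤ P B ∧ ∀ D ∈ C, t ≤ P D → P B ≤ P D := by
  -- Complements of the members form a saturated chain again, and maximality there is minimality
  -- here.
  obtain ⟨_, ⟨B, hB, rfl⟩, h1, h2⟩ := hC.compl.exists_max (P univ - t)
  have key : ∀ D ∈ C, (P Dᶜ ≤ P univ - t ↔ t ≤ P D) := by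
    intro D hD
    rw [measure_compl (hC.measurableSet D hD) (measure_ne_top _ _)]
    exact ENNReal.sub_le_sub_iff_left ht (measure_ne_top _ _)
  refine ⟨B, hB, (key B hB).1 h1, fun D hD hDt => ?_⟩
  have h3 := h2 Dᶜ ⟨D, hD, rfl⟩ ((key D hD).2 hDt)
  rw [measure_compl (hC.measurableSet D hD) (measure_ne_top _ _),
    measure_compl (hC.measurableSet B hB) (measure_ne_top _ _)] at h3
  exact (ENNReal.sub_le_sub_iff_left (measure_mono (subset_univ _)) (measure_ne_top _ _)).1 h3

/-- If the value `t` were skipped, let `A` and `B` be the members next to the gap. Atomlessness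
splits `B \ A`, giving a set of measure strictly between; it is comparable with every member, hence
a member inside the gap. -/
theorem exists_measure_eq [IsFiniteMeasure P] (hC : IsSaturatedAEChain P C) (hP : IsAtomless P)
    {t : ℝ≥0∞} (ht : t ≤ P univ) : ∃ A ∈ C, P A = t := by
  obtain ⟨A, hA, hAt, hAmax⟩ := hC.exists_max t
  obtain ⟨B, hB, hBt, hBmin⟩ := hC.exists_min ht
  by_contra! hno
  have hAlt : P A < t := lt_of_le_of_ne hAt (hno A hA)
  have hltB : t < P B := lt_of_le_of_ne hBt (hno B hB).symm
  have hmA := hC.measurableSet A hA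
  have hmB := hC.measurableSet B hB
  have hAB : A ≤ᵐ[P] B := hC.ae_le_of_measure_le hA hB (hAlt.le.trans hltB.le)
  have hdiff : P A + P (B \ A) = P B := by
    rw [← measure_union disjoint_sdiff_right (hmB.diff hmA), union_sdiff_self]
    have h := hAB.union (EventuallyLE.refl (ae P) B)
    rw [union_self] at h
    exact le_antisymm (measure_mono_ae h) (measure_mono subset_union_right)
  have hpos : 0 < P (B \ A) := by
    rw [pos_iff_ne_zero]
    intro h0
    rw [h0, add_zero] at hdiff
    exact (hAlt.trans hltB).ne hdiff
  obtain ⟨T, hTs, hmT, hT0, hT1⟩ := hP _ (hmB.diff hmA) hpos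
  have hPT : P (A ∪ T) = P A + P T :=
    measure_union (disjoint_sdiff_right.mono_right hTs) hmT
  have hmem : A ∪ T ∈ C := by
    refine hC.saturated _ (hmA.union hmT) fun D hD => ?_
    rcases le_total (P D) t with h | h
    · left
      exact (hC.ae_le_of_measure_le hD hA (hAmax D hD h)).trans
        (LE.le.eventuallyLE subset_union_left)
    · right
      have h1 : (A ∪ T : Set Ω) ≤ᵐ[P] B := by
        have h := hAB.union (LE.le.eventuallyLE (l := ae P) (hTs.trans sdiff_subset))
        rwa [union_self] at h
      exact h1.trans (hC.ae_le_of_measure_le hB hD (hBmin D hD h))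
  have hgt : P A < P (A ∪ T) := by
    rw [hPT]
    exact ENNReal.lt_add_right (measure_ne_top _ _) hT0.ne'
  have hlt : P (A ∪ T) < P B := by
    rw [hPT, ← hdiff]
    exact ENNReal.add_lt_add_left (measure_ne_top _ _) hT1
  rcases le_total (P (A ∪ T)) t with h | h
  · exact (hAmax _ hmem h).not_gt hgt
  · exact (hBmin _ hmem h).not_gt hlt

end IsSaturatedAEChain

/-- An atomless probability space carries a random variable that is uniform on `(0, 1)`. -/
theorem IsAtomless.exists_uniform {Ω : Type*} [MeasurableSpace Ω] {P : Measure Ω}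
    [IsProbabilityMeasure P] (hP : IsAtomless P) :
    ∃ U : Ω → ℝ, Measurable U ∧ (∀ ω, U ω ∈ Ioo (0 : ℝ) 1) ∧
      ∀ t ∈ Icc (0 : ℝ) 1, P {ω | U ω ≤ t} = ENNReal.ofReal t := by
  obtain ⟨C, hC⟩ := exists_isSaturatedAEChain P
  have hex : ∀ t : ℝ, ∃ A ∈ C, t ≤ 1 → P A = ENNReal.ofReal t := by
    intro t
    by_cases ht : t ≤ 1
    · obtain ⟨A, hA, h⟩ := hC.exists_measure_eq hP (t := ENNReal.ofReal t) (by simpa using ht)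
      exact ⟨A, hA, fun _ => h⟩
    · obtain ⟨A, hA, h⟩ := hC.exists_measure_eq hP (t := 0) (by simp)
      exact ⟨A, hA, fun h => absurd h ht⟩
  choose A hAC hA using hex
  let I : Set ℚ := {q : ℚ | 0 < (q : ℝ) ∧ (q : ℝ) < 1}
  -- The inserted `1` keeps the set non-empty and `V` at most `1`; rational levels keep the
  -- exceptional null sets countable in number.
  let V : Ω → ℝ := fun ω => sInf (insert 1 {x | ∃ q ∈ I, (q : ℝ) = x ∧ ω ∈ A q})
  have hbdd : ∀ ω, BddBelow (insert 1 {x | ∃ q ∈ I, (q : ℝ) = x ∧ ω ∈ A q}) := by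
    refine fun ω => ⟨0, ?_⟩
    rintro x (rfl | ⟨q, hq, rfl, -⟩)
    · exact zero_le_one
    · exact hq.1.le
  have hVlt : ∀ t ≤ 1, {ω | V ω < t} = ⋃ q ∈ {q : ℚ | q ∈ I ∧ (q : ℝ) < t}, A q := by
    intro t ht
    ext ω
    simp only [mem_ofPred_eq, mem_iUnion, exists_prop, V]
    rw [csInf_lt_iff (hbdd ω) (insert_nonempty _ _)]
    constructor
    · rintro ⟨x, rfl | ⟨q, hq, rfl, hω⟩, hx⟩
      · exact absurd hx ht.not_gt
      · exact ⟨q, ⟨hq, hx⟩, hω⟩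
    · rintro ⟨q, ⟨hq, hqt⟩, hω⟩
      exact ⟨q, Or.inr ⟨q, hq, rfl, hω⟩, hqt⟩
  have hV1 : ∀ ω, V ω ≤ 1 := fun ω => csInf_le (hbdd ω) (mem_insert _ _)
  have hmeas1 : ∀ t ≤ 1, MeasurableSet {ω | V ω < t} := by
    intro t ht
    rw [hVlt t ht]
    exact MeasurableSet.biUnion (to_countable _) fun q _ => hC.measurableSet _ (hAC q)
  have hVm : Measurable V := by
    refine measurable_of_Iio fun t => ?_
    rcases le_or_gt t 1 with ht | ht
    · exact hmeas1 t ht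
    · convert MeasurableSet.univ
      ext ω
      simpa using (hV1 ω).trans_lt ht
  have hVP : ∀ t ∈ Icc (0 : ℝ) 1, P {ω | V ω < t} = ENNReal.ofReal t := by
    intro t ht
    rw [hVlt t ht.2]
    apply le_antisymm
    · rw [← hA t ht.2]
      refine measure_mono_ae ?_
      have h1 : ∀ q ∈ {q : ℚ | q ∈ I ∧ (q : ℝ) < t}, A q ≤ᵐ[P] A t := by
        intro q hq
        refine hC.ae_le_of_measure_le (hAC _) (hAC _) ?_
        rw [hA q hq.1.2.le, hA t ht.2]
        exact ENNReal.ofReal_le_ofReal hq.2.le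
      have h2 : ∀ᵐ ω ∂P, ∀ q ∈ {q : ℚ | q ∈ I ∧ (q : ℝ) < t}, ω ∈ A q → ω ∈ A t :=
        (ae_ball_iff (to_countable _)).2 h1
      filter_upwards [h2] with ω hω h
      obtain ⟨q, hq, h⟩ := mem_iUnion₂.1 h
      exact hω q hq h
    · refine le_of_forall_lt fun c hc => ?_
      have hc' : c.toReal < t := by
        rwa [ENNReal.lt_ofReal_iff_toReal_lt hc.ne_top] at hc
      obtain ⟨q, hq1, hq2⟩ := exists_rat_btwn hc'
      have hq0 : 0 < (q : ℝ) := ENNReal.toReal_nonneg.trans_lt hq1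
      have hqI : q ∈ I := ⟨hq0, hq2.trans_le ht.2⟩
      calc c < ENNReal.ofReal q := by rwa [ENNReal.lt_ofReal_iff_toReal_lt hc.ne_top]
        _ = P (A q) := (hA q hqI.2.le).symm
        _ ≤ _ := measure_mono fun ω hω => mem_iUnion₂.2 ⟨q, ⟨hqI, hq2⟩, hω⟩
  have hV0 : P {ω | V ω ≤ 0} = 0 := by
    refine le_antisymm (ENNReal.le_of_forall_pos_le_add (fun ε hε _ => ?_)) bot_le
    have hmin : min (ε : ℝ) 1 ∈ Icc (0 : ℝ) 1 := ⟨by positivity, min_le_right _ _⟩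
    calc P {ω | V ω ≤ 0} ≤ P {ω | V ω < min (ε : ℝ) 1} :=
          measure_mono fun ω (h : V ω ≤ 0) => h.trans_lt (by positivity)
      _ = ENNReal.ofReal (min (ε : ℝ) 1) := hVP _ hmin
      _ ≤ ENNReal.ofReal ε := ENNReal.ofReal_le_ofReal (min_le_left _ _)
      _ = 0 + ε := by simp
  have hVone : P {ω | 1 ≤ V ω} = 0 := by
    have h := prob_compl_eq_zero_iff (μ := P) (hmeas1 1 le_rfl)
    rw [hVP 1 (by simp), ENNReal.ofReal_one] at h
    have h2 : {ω | 1 ≤ V ω} = {ω | V ω < 1}ᶜ := by ext; simp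
    rw [h2]
    exact h.2 rfl
  have hVae : ∀ᵐ ω ∂P, V ω ∈ Ioo (0 : ℝ) 1 := by
    have h1 : ∀ᵐ ω ∂P, ¬ V ω ≤ 0 := measure_eq_zero_iff_ae_notMem.1 hV0
    have h2 : ∀ᵐ ω ∂P, ¬ 1 ≤ V ω := measure_eq_zero_iff_ae_notMem.1 hVone
    filter_upwards [h1, h2] with ω h1 h2
    exact ⟨not_le.1 h1, not_le.1 h2⟩
  have hS : MeasurableSet (V ⁻¹' Ioo 0 1) := hVm measurableSet_Ioo
  classical
  -- The measure of `{V < t}` is what is known. Reflecting to `1 - V` turns the strict inequality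
  -- into the required `≤`; the value `1 / 2` on a null set forces all values into the open
  -- interval.
  refine ⟨(V ⁻¹' Ioo 0 1).piecewise (fun ω => 1 - V ω) (fun _ => 1 / 2),
    Measurable.piecewise hS (measurable_const.sub hVm) measurable_const, fun ω => ?_, fun t ht => ?_⟩
  · by_cases h : ω ∈ V ⁻¹' Ioo 0 1
    · rw [piecewise_eq_of_mem _ _ _ h]
      exact ⟨by linarith [h.2], by linarith [h.1]⟩
    · rw [piecewise_eq_of_notMem _ _ _ h]
      norm_num
  · have h1 : P {ω | V ω < 1 - t}ᶜ = ENNReal.ofReal t := by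
      rw [prob_compl_eq_one_sub (hmeas1 _ (by linarith [ht.1])),
        hVP _ ⟨by linarith [ht.2], by linarith [ht.1]⟩, ← ENNReal.ofReal_one,
        ← ENNReal.ofReal_sub _ (by linarith [ht.2])]
      congr 1
      ring
    rw [← h1]
    refine measure_congr ?_
    filter_upwards [hVae] with ω hω
    have h2 : ω ∈ V ⁻¹' Ioo 0 1 := hω
    apply propext
    change (V ⁻¹' Ioo 0 1).piecewise (fun ω => 1 - V ω) (fun _ => 1 / 2) ω ≤ t ↔ ¬ V ω < 1 - t
    rw [piecewise_eq_of_mem _ _ _ h2, not_lt]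
    constructor <;> intro h <;> linarith

/-! ### Quantile functions and almost sure representation -/

open ProbabilityTheory in
/-- The lower quantile function of a Borel probability measure on `ℝ`. -/
noncomputable def quantile (μ : ProbabilityMeasure ℝ) (u : ℝ) : ℝ :=
  sInf {x | u ≤ cdf (μ : Measure ℝ) x}

-- The infimum is attained, by right continuity of the distribution function. This Galois connection
-- yields both measurability and the law of the quantile transform.
open ProbabilityTheory in
theorem quantile_le_iff (μ : ProbabilityMeasure ℝ) {u : ℝ} (hu : u ∈ Ioo (0 : ℝ) 1) (x : ℝ) :
    quantile μ u ≤ x ↔ u ≤ cdf (μ : Measure ℝ) x := by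
  have hne : {x | u ≤ cdf (μ : Measure ℝ) x}.Nonempty :=
    (((tendsto_cdf_atTop (μ : Measure ℝ)).eventually (lt_mem_nhds hu.2)).exists).imp
      fun _ h => le_of_lt h
  have hbdd : BddBelow {x | u ≤ cdf (μ : Measure ℝ) x} := by
    obtain ⟨y, hy⟩ := ((tendsto_cdf_atBot (μ : Measure ℝ)).eventually (gt_mem_nhds hu.1)).exists
    refine ⟨y, fun z (hz : u ≤ _) => ?_⟩
    by_contra! h
    exact absurd ((monotone_cdf (μ : Measure ℝ)) h.le) (hy.trans_le hz).not_ge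
  constructor
  · intro h
    have h1 : ∀ y > x, u ≤ cdf (μ : Measure ℝ) y := by
      intro y hy
      obtain ⟨z, hz, hzy⟩ := (csInf_lt_iff hbdd hne).1 (lt_of_le_of_lt h hy)
      exact le_trans hz (monotone_cdf _ hzy.le)
    have h2 : Tendsto (cdf (μ : Measure ℝ)) (𝓝[>] x) (𝓝 (cdf (μ : Measure ℝ) x)) :=
      ((cdf (μ : Measure ℝ)).right_continuous x).mono_left (nhdsWithin_mono _ Ioi_subset_Ici_self)
    exact ge_of_tendsto h2 (eventually_nhdsWithin_of_forall h1)
  · exact fun h => csInf_le hbdd h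

theorem measurable_quantile_comp {Ω : Type*} [MeasurableSpace Ω] {U : Ω → ℝ} (hU : Measurable U)
    (hU1 : ∀ ω, U ω ∈ Ioo (0 : ℝ) 1) (μ : ProbabilityMeasure ℝ) :
    Measurable fun ω => quantile μ (U ω) := by
  refine measurable_of_Iic fun x => ?_
  have h : (fun ω => quantile μ (U ω)) ⁻¹' Iic x =
      U ⁻¹' Iic (ProbabilityTheory.cdf (μ : Measure ℝ) x) := by
    ext ω
    exact quantile_le_iff μ (hU1 ω) x
  rw [h]
  exact hU measurableSet_Iic

theorem map_quantile_comp {Ω : Type*} [MeasurableSpace Ω] {P : Measure Ω} [IsProbabilityMeasure P]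
    {U : Ω → ℝ} (hU : Measurable U) (hU1 : ∀ ω, U ω ∈ Ioo (0 : ℝ) 1)
    (hU2 : ∀ t ∈ Icc (0 : ℝ) 1, P {ω | U ω ≤ t} = ENNReal.ofReal t) (μ : ProbabilityMeasure ℝ) :
    P.map (fun ω => quantile μ (U ω)) = (μ : Measure ℝ) := by
  have hm := measurable_quantile_comp hU hU1 μ
  have := Measure.isProbabilityMeasure_map (μ := P) hm.aemeasurable
  refine Measure.ext_of_Iic _ _ fun x => ?_
  rw [Measure.map_apply hm measurableSet_Iic, ← ProbabilityTheory.ofReal_cdf,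
    ← hU2 _ ⟨ProbabilityTheory.cdf_nonneg _ x, ProbabilityTheory.cdf_le_one _ x⟩]
  congr 1
  ext ω
  exact quantile_le_iff μ (hU1 ω) x

open ProbabilityTheory in
theorem tendsto_cdf {μs : ℕ → ProbabilityMeasure ℝ} {μ : ProbabilityMeasure ℝ}
    (h : Tendsto μs atTop (𝓝 μ)) {x : ℝ} (hx : (μ : Measure ℝ) {x} = 0) :
    Tendsto (fun n => cdf (μs n : Measure ℝ) x) atTop (𝓝 (cdf (μ : Measure ℝ) x)) := by
  have h1 := ProbabilityMeasure.tendsto_measure_of_null_frontier_of_tendsto' h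
    (E := Iic x) (by rw [frontier_Iic]; exact hx)
  simp only [cdf_eq_real]
  exact (ENNReal.tendsto_toReal (measure_ne_top _ _)).comp h1

theorem exists_mem_Ioo_measure_singleton_eq_zero (μ : ProbabilityMeasure ℝ) {a b : ℝ}
    (hab : a < b) : ∃ x ∈ Ioo a b, (μ : Measure ℝ) {x} = 0 := by
  have hc : {x : ℝ | 0 < (μ : Measure ℝ) {x}}.Countable :=
    Measure.countable_meas_pos_of_disjoint_iUnion (fun x => measurableSet_singleton x)
      (fun x y hxy => by simpa using hxy)
  obtain ⟨x, hx, hx'⟩ := hc.dense_compl ℝ |>.exists_between hab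
  exact ⟨x, hx', by simpa using hx⟩

open ProbabilityTheory in
/-- Quantile functions of a weakly convergent sequence converge at every level that is not a value of
the limiting distribution function at a rational point. -/
theorem tendsto_quantile {μs : ℕ → ProbabilityMeasure ℝ} {μ : ProbabilityMeasure ℝ}
    (h : Tendsto μs atTop (𝓝 μ)) {u : ℝ} (hu : u ∈ Ioo (0 : ℝ) 1)
    (hne : ∀ q : ℚ, u ≠ cdf (μ : Measure ℝ) q) :
    Tendsto (fun n => quantile (μs n) u) atTop (𝓝 (quantile μ u)) := by
  refine tendsto_order.2 ⟨fun a ha => ?_, fun b hb => ?_⟩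
  · obtain ⟨x, hx, hx0⟩ := exists_mem_Ioo_measure_singleton_eq_zero μ ha
    have h1 : cdf (μ : Measure ℝ) x < u := by
      rw [← not_le, ← quantile_le_iff μ hu, not_le]
      exact hx.2
    filter_upwards [(tendsto_cdf h hx0).eventually (gt_mem_nhds h1)] with n hn
    refine hx.1.trans ?_
    rwa [← not_le, quantile_le_iff _ hu, not_le]
  · obtain ⟨q, hq1, hq2⟩ := exists_rat_btwn hb
    obtain ⟨x, hx, hx0⟩ := exists_mem_Ioo_measure_singleton_eq_zero μ hq2
    -- Strictness is where the excluded values of `u` enter; they are countably many, hence null for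
    -- a uniform variable.
    have h1 : u < cdf (μ : Measure ℝ) x :=
      (lt_of_le_of_ne ((quantile_le_iff μ hu _).1 hq1.le) (hne q)).trans_le
        (monotone_cdf _ hx.1.le)
    filter_upwards [(tendsto_cdf h hx0).eventually (lt_mem_nhds h1)] with n hn
    exact ((quantile_le_iff _ hu x).2 hn.le).trans_lt hx.2

theorem measure_uniform_eq_zero {Ω : Type*} [MeasurableSpace Ω] {P : Measure Ω}
    [IsProbabilityMeasure P] {U : Ω → ℝ} (hU1 : ∀ ω, U ω ∈ Ioo (0 : ℝ) 1)
    (hU : Measurable U)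
    (hU2 : ∀ t ∈ Icc (0 : ℝ) 1, P {ω | U ω ≤ t} = ENNReal.ofReal t) (t : ℝ) :
    P {ω | U ω = t} = 0 := by
  by_cases ht : t ∈ Ioo (0 : ℝ) 1
  · refine le_antisymm (ENNReal.le_of_forall_pos_le_add (fun ε hε _ => ?_)) bot_le
    have hs : t - min (ε : ℝ) t ∈ Icc (0 : ℝ) 1 :=
      ⟨by linarith [min_le_right (ε : ℝ) t],
        by linarith [ht.2, le_min (NNReal.coe_nonneg ε) ht.1.le]⟩
    have hlt : t - min (ε : ℝ) t < t := by
      have : 0 < min (ε : ℝ) t := lt_min hε ht.1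
      linarith
    have hsub : {ω | U ω = t} ⊆ {ω | U ω ≤ t} \ {ω | U ω ≤ t - min (ε : ℝ) t} := by
      intro ω (hω : U ω = t)
      exact ⟨hω.le, fun h : U ω ≤ _ => (hω ▸ h).not_gt hlt⟩
    have hss : {ω | U ω ≤ t - min (ε : ℝ) t} ⊆ {ω | U ω ≤ t} :=
      fun ω (h : U ω ≤ _) => h.trans hlt.le
    refine (measure_mono hsub).trans ?_
    rw [measure_sdiff hss
      (measurableSet_le hU measurable_const).nullMeasurableSet (measure_ne_top _ _),
      hU2 _ hs, hU2 _ ⟨ht.1.le, ht.2.le⟩, ← ENNReal.ofReal_sub _ hs.1, sub_sub_cancel, zero_add]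
    exact (ENNReal.ofReal_le_ofReal (min_le_left _ _)).trans (by simp)
  · convert measure_empty (μ := P)
    ext ω
    simp only [mem_ofPred_eq, mem_empty_iff_false, iff_false]
    rintro rfl
    exact ht (hU1 ω)

theorem ae_tendsto_quantile {Ω : Type*} [MeasurableSpace Ω] {P : Measure Ω}
    [IsProbabilityMeasure P] {U : Ω → ℝ} (hU : Measurable U) (hU1 : ∀ ω, U ω ∈ Ioo (0 : ℝ) 1)
    (hU2 : ∀ t ∈ Icc (0 : ℝ) 1, P {ω | U ω ≤ t} = ENNReal.ofReal t)
    {μs : ℕ → ProbabilityMeasure ℝ} {μ : ProbabilityMeasure ℝ} (h : Tendsto μs atTop (𝓝 μ)) :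
    ∀ᵐ ω ∂P, Tendsto (fun n => quantile (μs n) (U ω)) atTop (𝓝 (quantile μ (U ω))) := by
  have h1 : ∀ᵐ ω ∂P, ∀ q : ℚ, U ω ≠ ProbabilityTheory.cdf (μ : Measure ℝ) q := by
    rw [ae_all_iff]
    exact fun q => measure_eq_zero_iff_ae_notMem.1 (measure_uniform_eq_zero hU1 hU hU2 _)
  filter_upwards [h1] with ω hω
  exact tendsto_quantile h (hU1 ω) hω

/-! ### Modular convergence under the `Δ₂`-condition -/

/-- The dominated convergence theorem with converging dominating functions. -/
theorem tendsto_lintegral_zero_of_le_of_tendsto {Ω : Type*} [MeasurableSpace Ω] {P : Measure Ω}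
    {f g : ℕ → Ω → ℝ≥0∞} {G : Ω → ℝ≥0∞} (hf : ∀ n, Measurable (f n)) (hg : ∀ n, Measurable (g n))
    (hfg : ∀ n ω, f n ω ≤ g n ω) (hf0 : ∀ᵐ ω ∂P, Tendsto (fun n => f n ω) atTop (𝓝 0))
    (hgG : ∀ᵐ ω ∂P, Tendsto (fun n => g n ω) atTop (𝓝 (G ω))) (hG : ∫⁻ ω, G ω ∂P ≠ ∞)
    (hint : Tendsto (fun n => ∫⁻ ω, g n ω ∂P) atTop (𝓝 (∫⁻ ω, G ω ∂P))) :
    Tendsto (fun n => ∫⁻ ω, f n ω ∂P) atTop (𝓝 0) := by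
  have hh : ∀ n, Measurable (fun ω => g n ω - f n ω) := fun n => (hg n).sub (hf n)
  have hadd : ∀ n, ∫⁻ ω, f n ω ∂P + ∫⁻ ω, (g n ω - f n ω) ∂P = ∫⁻ ω, g n ω ∂P := by
    intro n
    rw [← lintegral_add_left (hf n)]
    exact lintegral_congr fun ω => add_tsub_cancel_of_le (hfg n ω)
  have hle : ∀ n, ∫⁻ ω, (g n ω - f n ω) ∂P ≤ ∫⁻ ω, g n ω ∂P := fun n =>
    lintegral_mono fun ω => tsub_le_self
  have hlim : ∀ᵐ ω ∂P, G ω = liminf (fun n => g n ω - f n ω) atTop := by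
    filter_upwards [hf0, hgG] with ω h1 h2
    have h := ENNReal.Tendsto.sub h2 h1 (Or.inr ENNReal.zero_ne_top)
    rw [tsub_zero] at h
    exact h.liminf_eq.symm
  -- Fatou's lemma for `g n - f n ≥ 0`; the integrals of these differences then converge to that of
  -- `G`, leaving nothing for `f n`.
  have hfatou : ∫⁻ ω, G ω ∂P ≤ liminf (fun n => ∫⁻ ω, (g n ω - f n ω) ∂P) atTop := by
    rw [lintegral_congr_ae hlim]
    exact lintegral_liminf_le hh
  have hsup : limsup (fun n => ∫⁻ ω, (g n ω - f n ω) ∂P) atTop ≤ ∫⁻ ω, G ω ∂P := by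
    rw [← hint.limsup_eq]
    exact limsup_le_limsup (Eventually.of_forall hle)
  have hth := tendsto_of_le_liminf_of_limsup_le hfatou hsup
  have hsub := ENNReal.Tendsto.sub hint hth (Or.inl hG)
  rw [tsub_self] at hsub
  refine hsub.congr' ?_
  filter_upwards [hint.eventually (gt_mem_nhds hG.lt_top)] with n hn
  exact (ENNReal.eq_sub_of_add_eq ((hle n).trans_lt hn).ne (hadd n)).symm

namespace FiniteYoungFunction

variable {Ψ : FiniteYoungFunction}

theorem Delta2.exists_two_mul_le (h : Ψ.Delta2) : ∃ C K : ℝ≥0, ∀ x, Ψ (2 * x) ≤ C * Ψ x + K := by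
  obtain ⟨C, x₀, -, -, h⟩ := h
  refine ⟨C, Ψ (2 * x₀), fun x => ?_⟩
  rcases le_total x₀ x with hx | hx
  · exact (h x hx).trans le_self_add
  · exact (Ψ.monotone' (mul_le_mul_right hx 2)).trans le_add_self

theorem Delta2.exists_pow_mul_le (h : Ψ.Delta2) (n : ℕ) :
    ∃ C K : ℝ≥0, ∀ x, Ψ (2 ^ n * x) ≤ C * Ψ x + K := by
  induction n with
  | zero => exact ⟨1, 0, fun x => by simp⟩
  | succ n ih =>
    obtain ⟨C, K, h1⟩ := ih
    obtain ⟨C', K', h2⟩ := h.exists_two_mul_le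
    refine ⟨C' * C, C' * K + K', fun x => ?_⟩
    calc Ψ (2 ^ (n + 1) * x) = Ψ (2 * (2 ^ n * x)) := by ring_nf
      _ ≤ C' * Ψ (2 ^ n * x) + K' := h2 _
      _ ≤ C' * (C * Ψ x + K) + K' := by gcongr; exact h1 x
      _ = C' * C * Ψ x + (C' * K + K') := by ring

theorem Delta2.exists_mul_add_le (h : Ψ.Delta2) (c : ℝ≥0) :
    ∃ C K : ℝ≥0, ∀ x y, Ψ (c * (x + y)) ≤ C * (Ψ x + Ψ y) + K := by
  -- Since `x + y` is at most twice the maximum, `c * (x + y)` is at most `2 ^ n` times the maximum.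
  obtain ⟨n, hn⟩ := pow_unbounded_of_one_lt (2 * c) (one_lt_two (α := ℝ≥0))
  obtain ⟨C, K, h1⟩ := h.exists_pow_mul_le n
  refine ⟨C, K, fun x y => ?_⟩
  have key : ∀ z, x + y ≤ 2 * z → Ψ (c * (x + y)) ≤ C * Ψ z + K := by
    intro z hz
    refine (Ψ.monotone' ?_).trans (h1 z)
    calc c * (x + y) ≤ c * (2 * z) := by gcongr
      _ = 2 * c * z := by ring
      _ ≤ 2 ^ n * z := by gcongr
  rcases le_total x y with hxy | hxy
  · refine (key y (by rw [two_mul]; gcongr)).trans ?_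
    gcongr
    exact le_add_self
  · refine (key x (by rw [two_mul]; gcongr)).trans ?_
    gcongr
    exact le_self_add

theorem measurable_comp_nnnorm {Ω : Type*} [MeasurableSpace Ω] {f : Ω → ℝ} (hf : Measurable f)
    (c : ℝ≥0) : Measurable fun ω => (Ψ (c * ‖f ω‖₊) : ℝ≥0∞) :=
  (Ψ.continuous'.measurable.comp (hf.nnnorm.const_mul c)).coe_nnreal_ennreal

/-- Under the `Δ₂`-condition, almost sure convergence together with convergence of the moments
`E[Ψ(|X|)]` implies modular convergence at all scales. -/
theorem Delta2.tendsto_modular {Ω : Type*} [MeasurableSpace Ω] {P : Measure Ω}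
    [IsProbabilityMeasure P] (hΨ : Ψ.Delta2) {f : ℕ → Ω → ℝ} {F : Ω → ℝ}
    (hf : ∀ n, Measurable (f n)) (hF : Measurable F)
    (hlim : ∀ᵐ ω ∂P, Tendsto (fun n => f n ω) atTop (𝓝 (F ω)))
    (hfin : ∫⁻ ω, (Ψ ‖F ω‖₊ : ℝ≥0∞) ∂P ≠ ∞)
    (hint : Tendsto (fun n => ∫⁻ ω, (Ψ ‖f n ω‖₊ : ℝ≥0∞) ∂P) atTop
      (𝓝 (∫⁻ ω, (Ψ ‖F ω‖₊ : ℝ≥0∞) ∂P))) (c : ℝ≥0) :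
    Tendsto (fun n => ∫⁻ ω, (Ψ (c * ‖f n ω - F ω‖₊) : ℝ≥0∞) ∂P) atTop (𝓝 0) := by
  obtain ⟨C, K, hCK⟩ := hΨ.exists_mul_add_le c
  have hmf : ∀ n, Measurable fun ω => (Ψ ‖f n ω‖₊ : ℝ≥0∞) := fun n => by
    simpa using measurable_comp_nnnorm (Ψ := Ψ) (hf n) 1
  have hmF : Measurable fun ω => (Ψ ‖F ω‖₊ : ℝ≥0∞) := by
    simpa using measurable_comp_nnnorm (Ψ := Ψ) hF 1
  have hlin : ∀ g : Ω → ℝ≥0∞, Measurable g →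
      ∫⁻ ω, ((C : ℝ≥0∞) * (g ω + (Ψ ‖F ω‖₊ : ℝ≥0∞)) + K) ∂P =
        C * (∫⁻ ω, g ω ∂P + ∫⁻ ω, (Ψ ‖F ω‖₊ : ℝ≥0∞) ∂P) + K := by
    intro g hg
    rw [lintegral_add_right _ measurable_const, lintegral_const_mul' _ _ ENNReal.coe_ne_top,
      lintegral_add_right _ hmF]
    simp
  refine tendsto_lintegral_zero_of_le_of_tendsto
    (g := fun n ω => (C : ℝ≥0∞) * ((Ψ ‖f n ω‖₊ : ℝ≥0∞) + (Ψ ‖F ω‖₊ : ℝ≥0∞)) + K)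
    (G := fun ω => (C : ℝ≥0∞) * ((Ψ ‖F ω‖₊ : ℝ≥0∞) + (Ψ ‖F ω‖₊ : ℝ≥0∞)) + K)
    (fun n => measurable_comp_nnnorm ((hf n).sub hF) c)
    (fun n => (((hmf n).add hmF).const_mul _).add_const _) ?_ ?_ ?_ ?_ ?_
  · intro n ω
    have h1 : Ψ (c * ‖f n ω - F ω‖₊) ≤ C * (Ψ ‖f n ω‖₊ + Ψ ‖F ω‖₊) + K :=
      (Ψ.monotone' (mul_le_mul_right (nnnorm_sub_le _ _) c)).trans (hCK _ _)
    exact_mod_cast h1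
  · filter_upwards [hlim] with ω hω
    have h1 : Tendsto (fun n => Ψ (c * ‖f n ω - F ω‖₊)) atTop (𝓝 (Ψ (c * ‖F ω - F ω‖₊))) :=
      (Ψ.continuous'.tendsto _).comp ((hω.sub_const _).nnnorm.const_mul c)
    rw [sub_self, nnnorm_zero, mul_zero, Ψ.map_zero'] at h1
    exact ENNReal.tendsto_coe.2 h1
  · filter_upwards [hlim] with ω hω
    have h1 : Tendsto (fun n => (C * (Ψ ‖f n ω‖₊ + Ψ ‖F ω‖₊) + K : ℝ≥0)) atTop
        (𝓝 (C * (Ψ ‖F ω‖₊ + Ψ ‖F ω‖₊) + K)) :=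
      ((((Ψ.continuous'.tendsto _).comp hω.nnnorm).add_const _).const_mul C).add_const K
    exact_mod_cast h1
  · rw [hlin _ hmF]
    finiteness
  · simp only [hlin _ (hmf _), hlin _ hmF]
    exact (ENNReal.Tendsto.const_mul (hint.add_const _) (Or.inr ENNReal.coe_ne_top)).add_const _

end FiniteYoungFunction

/-! ### Continuity of convex risk measures on the Orlicz heart -/

theorem mk_mem_orliczHeart {Ω : Type*} [MeasurableSpace Ω] {Ψ : FiniteYoungFunction}
    {P : Measure Ω} {f : Ω → ℝ} (hf : Measurable f)
    (h : ∀ c : ℝ≥0, ∫⁻ ω, (Ψ (c * ‖f ω‖₊) : ℝ≥0∞) ∂P < ∞) :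
    AEEqFun.mk f hf.aestronglyMeasurable ∈ orliczHeart Ψ P := by
  intro c _
  refine lt_of_eq_of_lt (lintegral_congr_ae ?_) (h c)
  filter_upwards [AEEqFun.coeFn_mk f hf.aestronglyMeasurable (μ := P)] with ω hω
  rw [hω]

theorem lintegral_lt_top_of_mem_orliczHeart {Ω : Type*} [MeasurableSpace Ω]
    {Ψ : FiniteYoungFunction} {P : Measure Ω} (X : orliczHeart Ψ P) (c : ℝ≥0) :
    ∫⁻ ω, (Ψ (c * ‖(X : Ω →ₘ[P] ℝ) ω‖₊) : ℝ≥0∞) ∂P < ∞ := by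
  rcases eq_or_ne c 0 with rfl | hc
  · simp [Ψ.map_zero']
  · exact X.2 c (pos_iff_ne_zero.2 hc)

/-- A sequence of random variables of fast decreasing modulars is dominated, with the factors
`1 / (k + 1)`, by one element of the Orlicz heart. -/
theorem exists_orliczHeart_dominating {Ω : Type*} [MeasurableSpace Ω] {Ψ : FiniteYoungFunction}
    {P : Measure Ω} (W : ℕ → orliczHeart Ψ P)
    (hW : ∀ k : ℕ, ∫⁻ ω, (Ψ ((k + 1) ^ 2 * ‖(W k : Ω →ₘ[P] ℝ) ω‖₊) : ℝ≥0∞) ∂P ≤ 2⁻¹ ^ k) :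
    ∃ Z : orliczHeart Ψ P, ∀ᵐ ω ∂P, ∀ k : ℕ,
      (k + 1) * |(W k : Ω →ₘ[P] ℝ) ω| ≤ (Z : Ω →ₘ[P] ℝ) ω := by
  let b : ℕ → Ω → ℝ≥0 := fun k ω => (k + 1) * ‖(W k : Ω →ₘ[P] ℝ) ω‖₊
  have hbm : ∀ k, Measurable (b k) := fun k => (W k : Ω →ₘ[P] ℝ).measurable.nnnorm.const_mul _
  have hΨm : ∀ (c : ℝ≥0) (k : ℕ), Measurable fun ω => (Ψ (c * b k ω) : ℝ≥0∞) := fun c k =>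
    (Ψ.continuous'.measurable.comp ((hbm k).const_mul c)).coe_nnreal_ennreal
  have hgeo : ∑' k : ℕ, (2⁻¹ : ℝ≥0∞) ^ k < ∞ := by
    rw [ENNReal.tsum_geometric_two]
    exact ENNReal.ofNat_lt_top
  -- For `k ≥ N ≥ c` the factor `c * (k + 1)` is below `(k + 1) ^ 2`, so the tail is geometric; the
  -- first `N` terms are finite by membership in the heart.
  have hsum : ∀ c : ℝ≥0, ∫⁻ ω, ∑' k, (Ψ (c * b k ω) : ℝ≥0∞) ∂P < ∞ := by
    intro c
    rw [lintegral_tsum fun k => (hΨm c k).aemeasurable]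
    obtain ⟨N, hN⟩ := exists_nat_ge c
    have hle : ∀ k : ℕ, ∫⁻ ω, (Ψ (c * b k ω) : ℝ≥0∞) ∂P ≤
        (if k ∈ Finset.range N then ∫⁻ ω, (Ψ (c * b k ω) : ℝ≥0∞) ∂P else 0) + 2⁻¹ ^ k := by
      intro k
      by_cases hk : k ∈ Finset.range N
      · rw [if_pos hk]
        exact le_self_add
      · rw [if_neg hk, zero_add]
        refine le_trans (lintegral_mono fun ω => ?_) (hW k)
        rw [ENNReal.coe_le_coe]
        refine Ψ.monotone' ?_
        rw [Finset.mem_range, not_lt] at hk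
        have h1 : c ≤ k + 1 := hN.trans ((Nat.cast_le.2 hk).trans le_self_add)
        calc c * b k ω ≤ (k + 1) * ((k + 1) * ‖(W k : Ω →ₘ[P] ℝ) ω‖₊) := by gcongr
          _ = _ := by ring
    refine (ENNReal.tsum_le_tsum hle).trans_lt ?_
    rw [ENNReal.tsum_add]
    refine ENNReal.add_lt_top.2 ⟨?_, hgeo⟩
    rw [tsum_eq_sum (s := Finset.range N) (fun k hk => if_neg hk)]
    refine ENNReal.sum_lt_top.2 fun k hk => ?_
    rw [if_pos hk]
    simpa only [b, ← mul_assoc] using lintegral_lt_top_of_mem_orliczHeart (W k) (c * (k + 1))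
  have hbdd : ∀ᵐ ω ∂P, BddAbove (range fun k => b k ω) := by
    have hm : Measurable fun ω => ∑' k, (Ψ (1 * b k ω) : ℝ≥0∞) :=
      Measurable.tsum fun k => hΨm 1 k
    filter_upwards [ae_lt_top hm (hsum 1).ne] with ω hω
    lift (∑' k, (Ψ (1 * b k ω) : ℝ≥0∞)) to ℝ≥0 using hω.ne with S hS
    obtain ⟨M, hM⟩ := (Ψ.tendsto_atTop'.eventually (eventually_gt_atTop S)).exists
    refine ⟨M, ?_⟩
    rintro _ ⟨k, rfl⟩
    by_contra! h
    have h1 : (Ψ (1 * b k ω) : ℝ≥0∞) ≤ S := hS ▸ ENNReal.le_tsum k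
    rw [ENNReal.coe_le_coe, one_mul] at h1
    exact (hM.trans_le (Ψ.monotone' h.le)).not_ge h1
  have hZm : Measurable fun ω => ((⨆ k, b k ω : ℝ≥0) : ℝ) := (Measurable.iSup hbm).coe_nnreal_real
  have hZ : ∀ c : ℝ≥0, ∫⁻ ω, (Ψ (c * ‖((⨆ k, b k ω : ℝ≥0) : ℝ)‖₊) : ℝ≥0∞) ∂P < ∞ := by
    intro c
    refine lt_of_le_of_lt (lintegral_mono fun ω => ?_) (hsum (2 * c))
    rw [NNReal.nnnorm_eq]
    -- An unbounded supremum in `ℝ≥0` has the default value `0`, so it falls under the first case. A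
    -- nonzero supremum is less than twice some `b k ω`, whence the factor `2 * c`.
    rcases eq_or_ne (⨆ k, b k ω) 0 with h0 | h0
    · simp [h0, Ψ.map_zero']
    · obtain ⟨k, hk⟩ := exists_lt_of_lt_ciSup (NNReal.half_lt_self h0)
      refine le_trans ?_ (ENNReal.le_tsum k)
      rw [ENNReal.coe_le_coe]
      refine Ψ.monotone' ?_
      calc c * (⨆ k, b k ω) = 2 * c * ((⨆ k, b k ω) / 2) := by field_simp
        _ ≤ 2 * c * b k ω := by gcongr
  refine ⟨⟨_, mk_mem_orliczHeart hZm hZ⟩, ?_⟩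
  filter_upwards [hbdd, AEEqFun.coeFn_mk _ hZm.aestronglyMeasurable (μ := P)] with ω h1 h2 k
  rw [h2]
  have h3 : b k ω ≤ ⨆ k, b k ω := le_ciSup h1 k
  have h4 : ((b k ω : ℝ≥0) : ℝ) ≤ ((⨆ k, b k ω : ℝ≥0) : ℝ) := NNReal.coe_le_coe.2 h3
  simpa [b] using h4

/-- Convex risk measures on the Orlicz heart are continuous. -/
theorem IsLawInvariantConvexRiskMeasure.tendsto {Ω : Type*} [MeasurableSpace Ω]
    {Ψ : FiniteYoungFunction} {P : Measure Ω} [IsProbabilityMeasure P] {ρ : orliczHeart Ψ P → ℝ}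
    (hρ : IsLawInvariantConvexRiskMeasure ρ) {Xs : ℕ → orliczHeart Ψ P} {X : orliczHeart Ψ P}
    (h : ∀ c : ℝ≥0, Tendsto (fun n => ∫⁻ ω,
      (Ψ (c * ‖((Xs n - X : orliczHeart Ψ P) : Ω →ₘ[P] ℝ) ω‖₊) : ℝ≥0∞) ∂P) atTop (𝓝 0)) :
    Tendsto (fun n => ρ (Xs n)) atTop (𝓝 (ρ X)) := by
  refine tendsto_of_subseq_tendsto fun ns hns => ?_
  have hex : ∀ k : ℕ, ∃ m, ∫⁻ ω, (Ψ ((k + 1) ^ 2 *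
      ‖((Xs (ns m) - X : orliczHeart Ψ P) : Ω →ₘ[P] ℝ) ω‖₊) : ℝ≥0∞) ∂P ≤ 2⁻¹ ^ k := fun k =>
    (((h ((k + 1) ^ 2)).comp hns).eventually
      (ge_mem_nhds (ENNReal.pow_pos (by simp) k))).exists
  choose ms hms using hex
  refine ⟨ms, ?_⟩
  obtain ⟨Z, hZ⟩ := exists_orliczHeart_dominating (fun k => Xs (ns (ms k)) - X) hms
  let t : ℕ → ℝ := fun k => 1 / ((k : ℝ) + 1)
  have ht0 : ∀ k, 0 ≤ t k := fun k => by positivity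
  have ht1 : ∀ k, t k ≤ 1 := fun k => by
    rw [div_le_one (by positivity)]
    linarith [Nat.cast_nonneg (α := ℝ) k]
  have htlim : Tendsto t atTop (𝓝 0) := tendsto_one_div_add_atTop_nhds_zero_nat
  let W : ℕ → orliczHeart Ψ P := fun k => Xs (ns (ms k)) - X
  have hup : ∀ (k : ℕ) (V : orliczHeart Ψ P),
      (∀ᵐ ω ∂P, |(V : Ω →ₘ[P] ℝ) ω| = |(W k : Ω →ₘ[P] ℝ) ω|) →
      ρ (X + V) ≤ (1 - t k) * ρ X + t k * ρ (X - Z) := by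
    intro k V hV
    have h1 : ρ (X + V) ≤ ρ ((1 - t k) • X + t k • (X - Z)) := by
      -- This convex combination lies below `X + V`, because `|V| ≤ t k * Z`.
      have he : (1 - t k) • X + t k • (X - Z) = X - t k • Z := by
        module
      rw [he]
      refine hρ.antitone _ _ ?_
      filter_upwards [hZ, hV, AEEqFun.coeFn_sub (X : Ω →ₘ[P] ℝ) (t k • (Z : Ω →ₘ[P] ℝ)),
        AEEqFun.coeFn_add (X : Ω →ₘ[P] ℝ) (V : Ω →ₘ[P] ℝ),
        AEEqFun.coeFn_smul (t k) (Z : Ω →ₘ[P] ℝ)] with ω hω h2 h3 h4 h5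
      have h6 := hω k
      rw [← h2] at h6
      have h7 : |(V : Ω →ₘ[P] ℝ) ω| ≤ t k * (Z : Ω →ₘ[P] ℝ) ω := by
        simp only [t]
        rw [one_div, ← div_eq_inv_mul, le_div_iff₀ (by positivity)]
        linarith
      simp only [Submodule.coe_sub, Submodule.coe_add, Submodule.coe_smul]
      rw [h3, h4, Pi.sub_apply, Pi.add_apply, h5, Pi.smul_apply, smul_eq_mul]
      linarith [neg_abs_le ((V : Ω →ₘ[P] ℝ) ω)]
    refine h1.trans ?_
    have h2 := hρ.convex.2 (mem_univ X) (mem_univ (X - Z)) (sub_nonneg.2 (ht1 k)) (ht0 k)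
      (sub_add_cancel _ _)
    simpa only [smul_eq_mul] using h2
  have hulim : Tendsto (fun k => (1 - t k) * ρ X + t k * ρ (X - Z)) atTop (𝓝 (ρ X)) := by
    have := ((htlim.const_sub 1).mul_const (ρ X)).add (htlim.mul_const (ρ (X - Z)))
    simpa using this
  have hXW : ∀ k, X + W k = Xs (ns (ms k)) := fun k => add_sub_cancel X _
  refine tendsto_of_tendsto_of_tendsto_of_le_of_le
    (g := fun k => 2 * ρ X - ((1 - t k) * ρ X + t k * ρ (X - Z))) ?_ hulim (fun k => ?_) fun k => ?_
  · have := hulim.const_sub (2 * ρ X)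
    rwa [two_mul, add_sub_cancel_right, ← two_mul] at this
  -- The lower bound reflects the upper one: `X` is the midpoint of `X + W k` and `X - W k`, so
  -- convexity gives `ρ (X + W k) ≥ 2 * ρ X - ρ (X - W k)`.
  · have h1 := hup k (-W k) (by
      filter_upwards [AEEqFun.coeFn_neg (W k : Ω →ₘ[P] ℝ)] with ω hω
      rw [Submodule.coe_neg, hω, Pi.neg_apply, abs_neg])
    have h2 := hρ.convex.2 (mem_univ (X + W k)) (mem_univ (X + -W k))
      (by norm_num : (0 : ℝ) ≤ 1 / 2) (by norm_num : (0 : ℝ) ≤ 1 / 2) (by norm_num)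
    have h3 : (1 / 2 : ℝ) • (X + W k) + (1 / 2 : ℝ) • (X + -W k) = X := by
      rw [← smul_add, add_add_add_comm, add_neg_cancel, add_zero, ← two_smul ℝ X, smul_smul]
      norm_num
    rw [h3, hXW, smul_eq_mul, smul_eq_mul] at h2
    dsimp only
    linarith
  · have h1 := hup k (W k) (Eventually.of_forall fun _ => rfl)
    rwa [hXW] at h1

/-! ### Continuity of risk functionals under the `Δ₂`-condition -/

theorem continuous_integral_heartLaws {Ω : Type*} [MeasurableSpace Ω] (Ψ : FiniteYoungFunction)
    (P : Measure Ω) [IsProbabilityMeasure P] {f : ℝ → ℝ} (hf : f ∈ gaugedFunctions Ψ.gauge) :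
    Continuous[heartLawsTopology Ψ P, inferInstance]
      (fun μ : heartLaws Ψ P => ∫ x, f x ∂((μ : ProbabilityMeasure ℝ) : Measure ℝ)) := by
  have h : Continuous[gaugedTopology Ψ.gauge, inferInstance] (fun μ : gaugedMeasures Ψ.gauge =>
      ∫ x, f x ∂((μ : ProbabilityMeasure ℝ) : Measure ℝ)) :=
    continuous_iff_le_induced.2 (iInf₂_le f hf)
  let := gaugedTopology Ψ.gauge
  let := heartLawsTopology Ψ P
  exact h.comp (continuous_induced_dom (f := inclusion (heartLaws_subset Ψ P)))

theorem FiniteYoungFunction.continuous_gauge (Ψ : FiniteYoungFunction) : Continuous Ψ.gauge :=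
  Ψ.continuous'.comp continuous_nnnorm

theorem boundedContinuous_mem_gaugedFunctions (Ψ : FiniteYoungFunction)
    (f : BoundedContinuousFunction ℝ ℝ) : ⇑f ∈ gaugedFunctions Ψ.gauge := by
  refine ⟨f.continuous, ‖f‖, fun x => ?_⟩
  have h1 : (1 : ℝ) ≤ 1 + Ψ.gauge x := by linarith [NNReal.coe_nonneg (Ψ.gauge x)]
  rw [abs_div, abs_of_pos (a := 1 + (Ψ.gauge x : ℝ)) (by linarith)]
  exact (div_le_self (abs_nonneg _) h1).trans (f.norm_coe_le_norm x)

theorem gauge_mem_gaugedFunctions (Ψ : FiniteYoungFunction) :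
    (fun x => (Ψ.gauge x : ℝ)) ∈ gaugedFunctions Ψ.gauge := by
  refine ⟨NNReal.continuous_coe.comp Ψ.continuous_gauge, 1, fun x => ?_⟩
  have h0 := NNReal.coe_nonneg (Ψ.gauge x)
  rw [abs_of_nonneg (by positivity), div_le_one (by positivity)]
  linarith

/-- The topology on the laws of the Orlicz heart generated by weak convergence and the integral of
the gauge function. -/
@[reducible] noncomputable def weakGaugeTopology {Ω : Type*} [MeasurableSpace Ω]
    (Ψ : FiniteYoungFunction) (P : Measure Ω) [IsProbabilityMeasure P] :
    TopologicalSpace (heartLaws Ψ P) :=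
  TopologicalSpace.induced (fun μ => ((μ : ProbabilityMeasure ℝ),
    ∫ x, (Ψ.gauge x : ℝ) ∂((μ : ProbabilityMeasure ℝ) : Measure ℝ))) inferInstance

/-- Bounded continuous functions and the gauge itself are admissible test functions. The coarser
topology is first countable, so continuity for it, which is stronger, can be checked on sequences.
-/
theorem heartLawsTopology_le_weakGaugeTopology {Ω : Type*} [MeasurableSpace Ω]
    (Ψ : FiniteYoungFunction) (P : Measure Ω) [IsProbabilityMeasure P] :
    heartLawsTopology Ψ P ≤ weakGaugeTopology Ψ P := by
  rw [← continuous_iff_le_induced]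
  let := heartLawsTopology Ψ P
  refine Continuous.prodMk ?_ (continuous_integral_heartLaws Ψ P (gauge_mem_gaugedFunctions Ψ))
  exact ProbabilityMeasure.continuous_iff_forall_continuous_integral.2 fun f =>
    continuous_integral_heartLaws Ψ P (boundedContinuous_mem_gaugedFunctions Ψ f)

/-- Membership in the heart depends only on the law, so every law is realised within the heart
through the same `U`. -/
theorem exists_orliczHeart_eq_quantile {Ω : Type*} [MeasurableSpace Ω] {Ψ : FiniteYoungFunction}
    {P : Measure Ω} [IsProbabilityMeasure P] {U : Ω → ℝ} (hU : Measurable U)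
    (hU1 : ∀ ω, U ω ∈ Ioo (0 : ℝ) 1)
    (hU2 : ∀ t ∈ Icc (0 : ℝ) 1, P {ω | U ω ≤ t} = ENNReal.ofReal t) (μ : heartLaws Ψ P) :
    ∃ X : orliczHeart Ψ P, rvLaw (X : Ω →ₘ[P] ℝ) = μ ∧
      (X : Ω →ₘ[P] ℝ) =ᵐ[P] fun ω => quantile μ (U ω) := by
  have hm := measurable_quantile_comp hU hU1 (μ : ProbabilityMeasure ℝ)
  have hlaw := map_quantile_comp hU hU1 hU2 (μ : ProbabilityMeasure ℝ)
  have hΨ : ∀ c : ℝ≥0, Measurable fun x : ℝ => (Ψ (c * ‖x‖₊) : ℝ≥0∞) := fun c =>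
    FiniteYoungFunction.measurable_comp_nnnorm measurable_id c
  have hmem : ∀ c : ℝ≥0, ∫⁻ ω, (Ψ (c * ‖quantile μ (U ω)‖₊) : ℝ≥0∞) ∂P < ∞ := by
    intro c
    obtain ⟨Y, hY⟩ := μ.2
    have hY' : P.map (Y : Ω →ₘ[P] ℝ) = ((μ : ProbabilityMeasure ℝ) : Measure ℝ) :=
      congrArg (fun ν : ProbabilityMeasure ℝ => (ν : Measure ℝ)) hY
    rw [← lintegral_map (hΨ c) hm, hlaw, ← hY',
      lintegral_map (hΨ c) (Y : Ω →ₘ[P] ℝ).measurable]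
    exact lintegral_lt_top_of_mem_orliczHeart Y c
  refine ⟨⟨_, mk_mem_orliczHeart hm hmem⟩, ?_, AEEqFun.coeFn_mk _ _⟩
  apply Subtype.ext
  change P.map (AEEqFun.mk _ hm.aestronglyMeasurable) = _
  rw [Measure.map_congr (AEEqFun.coeFn_mk _ hm.aestronglyMeasurable), hlaw]
  rfl

/-- Under the `Δ₂`-condition, every law-invariant convex risk measure on the Orlicz heart has a
continuous risk functional. -/
theorem IsLawInvariantConvexRiskMeasure.continuous_riskFunctional {Ω : Type*} [MeasurableSpace Ω]
    {Ψ : FiniteYoungFunction} {P : Measure Ω} [IsProbabilityMeasure P] (hP : IsAtomless P)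
    (hΨ : Ψ.Delta2) {ρ : orliczHeart Ψ P → ℝ} (hρ : IsLawInvariantConvexRiskMeasure ρ) :
    Continuous[heartLawsTopology Ψ P, inferInstance] (riskFunctional ρ) := by
  refine continuous_le_dom (heartLawsTopology_le_weakGaugeTopology Ψ P) ?_
  let : TopologicalSpace (heartLaws Ψ P) := weakGaugeTopology Ψ P
  have : FirstCountableTopology (heartLaws Ψ P) :=
    TopologicalSpace.firstCountableTopology_induced _ _ _
  refine continuous_iff_seqContinuous.2 fun μs μ hμ => ?_
  have hind : IsInducing (fun ν : heartLaws Ψ P => ((ν : ProbabilityMeasure ℝ),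
    ∫ x, (Ψ.gauge x : ℝ) ∂((ν : ProbabilityMeasure ℝ) : Measure ℝ))) := ⟨rfl⟩
  have hg := (hind.continuous.tendsto μ).comp hμ
  have hg1 : Tendsto (fun n => (μs n : ProbabilityMeasure ℝ)) atTop (𝓝 μ) := hg.fst_nhds
  have hg2 : Tendsto (fun n => ∫ x, (Ψ.gauge x : ℝ) ∂((μs n : ProbabilityMeasure ℝ) : Measure ℝ))
    atTop (𝓝 (∫ x, (Ψ.gauge x : ℝ) ∂((μ : ProbabilityMeasure ℝ) : Measure ℝ))) := hg.snd_nhds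
  obtain ⟨U, hU, hU1, hU2⟩ := hP.exists_uniform
  choose X hXlaw hXae using exists_orliczHeart_eq_quantile (Ψ := Ψ) hU hU1 hU2
  have hR : ∀ ν, riskFunctional ρ ν = ρ (X ν) := by
    intro ν
    rw [← riskFunctional_law hρ (X ν)]
    congr 1
    exact Subtype.ext (hXlaw ν).symm
  have hm : ∀ ν : heartLaws Ψ P, Measurable fun ω => quantile ν (U ω) := fun ν =>
    measurable_quantile_comp hU hU1 _
  have hgm : Measurable fun x => (Ψ.gauge x : ℝ≥0∞) :=
    Ψ.continuous_gauge.measurable.coe_nnreal_ennreal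
  have hmom : ∀ ν : heartLaws Ψ P, ∫⁻ ω, (Ψ ‖quantile ν (U ω)‖₊ : ℝ≥0∞) ∂P =
      ∫⁻ x, (Ψ.gauge x : ℝ≥0∞) ∂((ν : ProbabilityMeasure ℝ) : Measure ℝ) := by
    intro ν
    rw [← map_quantile_comp hU hU1 hU2 (ν : ProbabilityMeasure ℝ), lintegral_map hgm (hm ν)]
    rfl
  have hfin : ∀ ν : heartLaws Ψ P, ∫⁻ ω, (Ψ ‖quantile ν (U ω)‖₊ : ℝ≥0∞) ∂P ≠ ∞ := by
    intro ν
    rw [hmom]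
    exact (heartLaws_subset Ψ P ν.2 : _ < _).ne
  have hreal : ∀ ν : heartLaws Ψ P,
      ∫ x, (Ψ.gauge x : ℝ) ∂((ν : ProbabilityMeasure ℝ) : Measure ℝ) =
        (∫⁻ ω, (Ψ ‖quantile ν (U ω)‖₊ : ℝ≥0∞) ∂P).toReal := by
    intro ν
    rw [hmom, integral_eq_lintegral_of_nonneg_ae (Eventually.of_forall fun x => NNReal.coe_nonneg _)
      (NNReal.continuous_coe.comp Ψ.continuous_gauge).aestronglyMeasurable]
    simp
  simp only [hreal] at hg2
  rw [ENNReal.tendsto_toReal_iff (fun n => hfin _) (hfin _)] at hg2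
  simp only [Function.comp_def, hR]
  refine hρ.tendsto fun c => ?_
  refine (hΨ.tendsto_modular (fun n => hm (μs n)) (hm μ) (ae_tendsto_quantile hU hU1 hU2 hg1)
    (hfin μ) hg2 c).congr fun n => lintegral_congr_ae ?_
  filter_upwards [hXae (μs n), hXae μ,
    AEEqFun.coeFn_sub (X (μs n) : Ω →ₘ[P] ℝ) (X μ : Ω →ₘ[P] ℝ)] with ω h1 h2 h3
  rw [Submodule.coe_sub, h3, Pi.sub_apply, h1, h2]

/-! ### Loss functions and failure of the `Δ₂`-condition -/

namespace FiniteYoungFunction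

variable (Ψ : FiniteYoungFunction)

theorem continuous_loss (a : ℝ≥0) : Continuous (Ψ.loss a) :=
  Ψ.continuous'.comp (continuous_const.mul continuous_real_toNNReal)

theorem monotone_loss (a : ℝ≥0) : Monotone (Ψ.loss a) := fun _ _ h =>
  Ψ.monotone' (mul_le_mul_right (Real.toNNReal_le_toNNReal h) a)

theorem loss_of_nonpos (a : ℝ≥0) {x : ℝ} (hx : x ≤ 0) : Ψ.loss a x = 0 := by
  rw [loss, Real.toNNReal_of_nonpos hx, mul_zero, Ψ.map_zero']

theorem loss_convex_combination_le (a : ℝ≥0) (x y : ℝ) {s t : ℝ≥0} (hst : s + t = 1) :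
    Ψ.loss a (s * x + t * y) ≤ s * Ψ.loss a x + t * Ψ.loss a y := by
  have h1 : (s * x + t * y : ℝ).toNNReal ≤ s * x.toNNReal + t * y.toNNReal := by
    rw [Real.toNNReal_le_iff_le_coe]
    push_cast
    gcongr <;> exact Real.le_coe_toNNReal _
  have h2 := Ψ.convex'.2 (mem_univ (a * x.toNNReal)) (mem_univ (a * y.toNNReal))
    (bot_le : 0 ≤ s) (bot_le : 0 ≤ t) hst
  refine (Ψ.monotone' (mul_le_mul_right h1 a)).trans ?_
  simp only [smul_eq_mul] at h2
  refine le_of_eq_of_le (congrArg Ψ ?_) h2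
  ring

theorem tendsto_loss_atTop {a : ℝ≥0} (ha : 0 < a) : Tendsto (Ψ.loss a) atTop atTop :=
  Ψ.tendsto_atTop'.comp (tendsto_real_toNNReal_atTop.const_mul_atTop ha)

/-- If the `Δ₂`-condition fails, then it fails along points tending to infinity. -/
theorem exists_seq_of_not_delta2 (h : ¬ Ψ.Delta2) :
    ∃ a : ℕ → ℝ≥0, ∀ n : ℕ, (n : ℝ≥0) + 1 ≤ Ψ (a n) ∧ (n + 1) * Ψ (a n) < Ψ (2 * a n) := by
  have hex : ∀ n : ℕ, ∃ x, (n : ℝ≥0) + 1 ≤ Ψ x ∧ (n + 1) * Ψ x < Ψ (2 * x) := by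
    intro n
    obtain ⟨x₁, hx₁⟩ := eventually_atTop.1 (Ψ.tendsto_atTop'.eventually_ge_atTop ((n : ℝ≥0) + 1))
    by_contra! hno
    refine h ⟨n + 1, x₁ + 1, by positivity, by positivity, fun x hx => hno x (hx₁ x ?_)⟩
    exact le_self_add.trans hx
  choose a ha using hex
  exact ⟨a, ha⟩

end FiniteYoungFunction

/-! ### The shortfall risk measure -/

section Shortfall

variable {Ω : Type*} [MeasurableSpace Ω] {Ψ : FiniteYoungFunction} {P : Measure Ω}

theorem mem_acceptableCash {ℓ : ℝ → ℝ≥0} {x₀ : ℝ≥0} {X : Ω →ₘ[P] ℝ} {m : ℝ} :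
    m ∈ acceptableCash ℓ x₀ X ↔ ∫⁻ ω, (ℓ (-X ω - m) : ℝ≥0∞) ∂P ≤ x₀ := Iff.rfl

theorem measurable_loss_comp (a : ℝ≥0) (X : Ω →ₘ[P] ℝ) (m : ℝ) :
    Measurable fun ω => (Ψ.loss a (-X ω - m) : ℝ≥0∞) :=
  ((Ψ.continuous_loss a).measurable.comp (X.measurable.neg.sub_const m)).coe_nnreal_ennreal

theorem acceptableCash_nonempty (a : ℝ≥0) {x₀ : ℝ≥0} (hx₀ : 0 < x₀) (X : orliczHeart Ψ P) :
    (acceptableCash (Ψ.loss a) x₀ (X : Ω →ₘ[P] ℝ)).Nonempty := by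
  have h : Tendsto (fun n : ℕ => ∫⁻ ω, (Ψ.loss a (-(X : Ω →ₘ[P] ℝ) ω - n) : ℝ≥0∞) ∂P) atTop
      (𝓝 (∫⁻ _, 0 ∂P)) := by
    refine tendsto_lintegral_of_dominated_convergence
      (fun ω => (Ψ (a * ‖(X : Ω →ₘ[P] ℝ) ω‖₊) : ℝ≥0∞))
      (fun n => measurable_loss_comp a _ _) (fun n => Eventually.of_forall fun ω => ?_)
      (lintegral_lt_top_of_mem_orliczHeart X a).ne (Eventually.of_forall fun ω => ?_)
    · rw [ENNReal.coe_le_coe]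
      refine Ψ.monotone' (mul_le_mul_right ?_ a)
      rw [Real.toNNReal_le_iff_le_coe, coe_nnnorm, Real.norm_eq_abs]
      linarith [neg_abs_le ((X : Ω →ₘ[P] ℝ) ω), Nat.cast_nonneg (α := ℝ) n]
    · obtain ⟨N, hN⟩ := exists_nat_ge (-(X : Ω →ₘ[P] ℝ) ω)
      refine tendsto_const_nhds.congr' ?_
      filter_upwards [eventually_ge_atTop N] with n hn
      have : (N : ℝ) ≤ n := Nat.cast_le.2 hn
      rw [Ψ.loss_of_nonpos a (by linarith), ENNReal.coe_zero]
  rw [lintegral_zero] at h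
  obtain ⟨n, hn⟩ := (h.eventually (ge_mem_nhds (ENNReal.coe_pos.2 hx₀))).exists
  exact ⟨n, hn⟩

theorem acceptableCash_bddBelow [IsProbabilityMeasure P] {a : ℝ≥0} (ha : 0 < a) (x₀ : ℝ≥0)
    (X : Ω →ₘ[P] ℝ) : BddBelow (acceptableCash (Ψ.loss a) x₀ X) := by
  -- At cash `-n` the loss tends to infinity pointwise, so by Fatou's lemma its expectation does too
  -- and eventually exceeds `x₀`.
  have hfatou : (∞ : ℝ≥0∞) ≤
      liminf (fun n : ℕ => ∫⁻ ω, (Ψ.loss a (-X ω - (-(n : ℝ))) : ℝ≥0∞) ∂P) atTop := by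
    calc (∞ : ℝ≥0∞)
        = ∫⁻ ω, liminf (fun n : ℕ => (Ψ.loss a (-X ω - (-(n : ℝ))) : ℝ≥0∞)) atTop ∂P := by
          have h1 : ∀ ω, liminf (fun n : ℕ => (Ψ.loss a (-X ω - (-(n : ℝ))) : ℝ≥0∞)) atTop = ∞ := by
            intro ω
            refine Tendsto.liminf_eq (ENNReal.tendsto_coe_nhds_top.2 ?_)
            refine (Ψ.tendsto_loss_atTop ha).comp ?_
            simp only [sub_neg_eq_add]
            exact tendsto_atTop_add_const_left _ _ tendsto_natCast_atTop_atTop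
          simp only [h1, lintegral_const, measure_univ, mul_one]
      _ ≤ _ := lintegral_liminf_le fun n => measurable_loss_comp a _ _
  have h2 : ∀ᶠ n : ℕ in atTop, (x₀ : ℝ≥0∞) < ∫⁻ ω, (Ψ.loss a (-X ω - (-(n : ℝ))) : ℝ≥0∞) ∂P :=
    eventually_lt_of_lt_liminf (ENNReal.coe_lt_top.trans_le hfatou)
  obtain ⟨n, hn⟩ := h2.exists
  refine ⟨-n, fun m hm => ?_⟩
  rw [mem_acceptableCash] at hm
  by_contra! hlt
  refine (hn.trans_le (le_trans (lintegral_mono fun ω => ?_) hm)).false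
  rw [ENNReal.coe_le_coe]
  exact Ψ.monotone_loss a (by linarith)

/-- The shortfall risk measure with loss function `Ψ (a x⁺)` is a law-invariant convex risk
measure. -/
theorem isLawInvariantConvexRiskMeasure_shortfallRisk [IsProbabilityMeasure P] {a x₀ : ℝ≥0}
    (ha : 0 < a) (hx₀ : 0 < x₀) :
    IsLawInvariantConvexRiskMeasure (shortfallRisk Ψ P (Ψ.loss a) x₀) where
  antitone := by
    intro X Y hXY
    refine csInf_le_csInf (acceptableCash_bddBelow ha x₀ _) (acceptableCash_nonempty a hx₀ X) ?_
    intro m hm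
    rw [mem_acceptableCash] at hm ⊢
    refine le_trans (lintegral_mono_ae ?_) hm
    filter_upwards [hXY] with ω hω
    rw [ENNReal.coe_le_coe]
    exact Ψ.monotone_loss a (by linarith)
  convex := by
    refine ⟨convex_univ, fun X _ Y _ s t hs ht hst => ?_⟩
    lift s to ℝ≥0 using hs
    lift t to ℝ≥0 using ht
    have hst' : s + t = 1 := by exact_mod_cast hst
    have key : ∀ m ∈ acceptableCash (Ψ.loss a) x₀ (X : Ω →ₘ[P] ℝ),
        ∀ m' ∈ acceptableCash (Ψ.loss a) x₀ (Y : Ω →ₘ[P] ℝ),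
        shortfallRisk Ψ P (Ψ.loss a) x₀ ((s : ℝ) • X + (t : ℝ) • Y) ≤ s * m + t * m' := by
      intro m hm m' hm'
      rw [mem_acceptableCash] at hm hm'
      refine csInf_le (acceptableCash_bddBelow ha x₀ _) ?_
      rw [mem_acceptableCash]
      calc ∫⁻ ω, (Ψ.loss a (-(((s : ℝ) • X + (t : ℝ) • Y : orliczHeart Ψ P) : Ω →ₘ[P] ℝ) ω -
            (s * m + t * m')) : ℝ≥0∞) ∂P
          ≤ ∫⁻ ω, ((s : ℝ≥0∞) * Ψ.loss a (-(X : Ω →ₘ[P] ℝ) ω - m) +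
              t * Ψ.loss a (-(Y : Ω →ₘ[P] ℝ) ω - m')) ∂P := by
            refine lintegral_mono_ae ?_
            filter_upwards [AEEqFun.coeFn_add ((s : ℝ) • (X : Ω →ₘ[P] ℝ)) ((t : ℝ) • (Y : Ω →ₘ[P] ℝ)),
              AEEqFun.coeFn_smul (s : ℝ) (X : Ω →ₘ[P] ℝ),
              AEEqFun.coeFn_smul (t : ℝ) (Y : Ω →ₘ[P] ℝ)] with ω h1 h2 h3
            simp only [Submodule.coe_add, Submodule.coe_smul]
            rw [h1, Pi.add_apply, h2, h3, Pi.smul_apply, Pi.smul_apply, smul_eq_mul, smul_eq_mul]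
            have h4 := Ψ.loss_convex_combination_le a (-(X : Ω →ₘ[P] ℝ) ω - m)
              (-(Y : Ω →ₘ[P] ℝ) ω - m') hst'
            have h5 : -(s * (X : Ω →ₘ[P] ℝ) ω + t * (Y : Ω →ₘ[P] ℝ) ω) - (s * m + t * m') =
              s * (-(X : Ω →ₘ[P] ℝ) ω - m) + t * (-(Y : Ω →ₘ[P] ℝ) ω - m') := by ring
            rw [h5]
            exact_mod_cast h4
        _ = s * ∫⁻ ω, (Ψ.loss a (-(X : Ω →ₘ[P] ℝ) ω - m) : ℝ≥0∞) ∂P +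
              t * ∫⁻ ω, (Ψ.loss a (-(Y : Ω →ₘ[P] ℝ) ω - m') : ℝ≥0∞) ∂P := by
            rw [lintegral_add_left ((measurable_loss_comp a _ _).const_mul _),
              lintegral_const_mul' _ _ ENNReal.coe_ne_top,
              lintegral_const_mul' _ _ ENNReal.coe_ne_top]
        _ ≤ s * x₀ + t * x₀ := by gcongr
        _ = x₀ := by rw [← add_mul, ← ENNReal.coe_add, hst', ENNReal.coe_one, one_mul]
    refine le_of_forall_pos_le_add fun ε hε => ?_
    obtain ⟨m, hm, hm1⟩ := exists_lt_of_csInf_lt (acceptableCash_nonempty a hx₀ X)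
      (lt_add_of_pos_right (shortfallRisk Ψ P (Ψ.loss a) x₀ X) hε)
    obtain ⟨m', hm', hm1'⟩ := exists_lt_of_csInf_lt (acceptableCash_nonempty a hx₀ Y)
      (lt_add_of_pos_right (shortfallRisk Ψ P (Ψ.loss a) x₀ Y) hε)
    have h1 := key m hm m' hm'
    have h2 := mul_le_mul_of_nonneg_left hm1.le s.coe_nonneg
    have h3 := mul_le_mul_of_nonneg_left hm1'.le t.coe_nonneg
    have h4 : (s : ℝ) * ε + t * ε = ε := by rw [← add_mul, hst, one_mul]
    rw [smul_eq_mul, smul_eq_mul]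
    linarith
  law_invariant := by
    intro X Y hXY
    have hmap : P.map (X : Ω →ₘ[P] ℝ) = P.map (Y : Ω →ₘ[P] ℝ) :=
      congrArg (fun ν : ProbabilityMeasure ℝ => (ν : Measure ℝ)) hXY
    have hm : ∀ m : ℝ, Measurable fun x : ℝ => (Ψ.loss a (-x - m) : ℝ≥0∞) := fun m =>
      ((Ψ.continuous_loss a).measurable.comp (measurable_neg.sub_const m)).coe_nnreal_ennreal
    unfold shortfallRisk
    congr 1
    ext m
    rw [mem_acceptableCash, mem_acceptableCash,
      ← lintegral_map (hm m) (X : Ω →ₘ[P] ℝ).measurable, hmap,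
      lintegral_map (hm m) (Y : Ω →ₘ[P] ℝ).measurable]

end Shortfall

/-! ### Discontinuity without the `Δ₂`-condition -/

theorem tendsto_heartLaws {Ω : Type*} [MeasurableSpace Ω] {Ψ : FiniteYoungFunction}
    {P : Measure Ω} [IsProbabilityMeasure P] {μs : ℕ → heartLaws Ψ P} {μ : heartLaws Ψ P}
    (h : ∀ f ∈ gaugedFunctions Ψ.gauge,
      Tendsto (fun n => ∫ x, f x ∂((μs n : ProbabilityMeasure ℝ) : Measure ℝ)) atTop
        (𝓝 (∫ x, f x ∂((μ : ProbabilityMeasure ℝ) : Measure ℝ)))) :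
    Tendsto μs atTop (@nhds _ (heartLawsTopology Ψ P) μ) := by
  rw [@nhds_induced _ _ (gaugedTopology Ψ.gauge) (inclusion (heartLaws_subset Ψ P)) μ,
    tendsto_comap_iff]
  simp only [nhds_iInf, tendsto_iInf]
  intro f hf
  rw [nhds_induced, tendsto_comap_iff]
  exact h f hf

/-- If the `Δ₂`-condition fails, the risk functional of the shortfall risk measure with loss function
`Ψ (8 x⁺)` is discontinuous at the law of `0`. -/
theorem not_continuous_riskFunctional_shortfallRisk {Ω : Type*} [MeasurableSpace Ω]
    {Ψ : FiniteYoungFunction} {P : Measure Ω} [IsProbabilityMeasure P] (hP : IsAtomless P)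
    (hΨ : ¬ Ψ.Delta2) {x₀ : ℝ≥0} (hx₀ : 0 < x₀) :
    ¬ Continuous[heartLawsTopology Ψ P, inferInstance]
      (riskFunctional (shortfallRisk Ψ P (Ψ.loss 8) x₀)) := by
  intro hcont
  have hρ := isLawInvariantConvexRiskMeasure_shortfallRisk (Ψ := Ψ) (P := P) (a := 8)
    (by norm_num) hx₀
  obtain ⟨a, ha⟩ := Ψ.exists_seq_of_not_delta2 hΨ
  obtain ⟨U, hU, -, hU2⟩ := hP.exists_uniform
  -- Only `8 ≥ 2` matters here.
  have hB : ∀ n : ℕ, ((n : ℝ≥0) + 1) * Ψ (a n) < Ψ (8 * a n) := fun n =>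
    (ha n).2.trans_le (Ψ.monotone' (by gcongr; norm_num))
  have hapos : ∀ n : ℕ, 1 ≤ Ψ (a n) := fun n => le_add_self.trans (ha n).1
  have hBpos : ∀ n : ℕ, (n : ℝ≥0) + 1 < Ψ (8 * a n) := fun n =>
    (le_mul_of_one_le_right bot_le (hapos n)).trans_lt (hB n)
  have hBpos' : ∀ n : ℕ, 0 < Ψ (8 * a n) := fun n => bot_le.trans_lt (hBpos n)
  -- Chosen so that `p n * Ψ (8 * a n) = 2 * x₀`, above the threshold, while `p n * (1 + Ψ (a n))`
  -- tends to `0`. The cap at `1` is inactive for large `n`.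
  let p : ℕ → ℝ≥0 := fun n => min 1 (2 * x₀ / Ψ (8 * a n))
  have hp1 : ∀ n, p n ≤ 1 := fun n => min_le_left _ _
  have hp2 : ∀ n : ℕ, p n * (1 + Ψ (a n)) ≤ 4 * x₀ * (1 / ((n : ℝ≥0) + 1)) := by
    intro n
    calc p n * (1 + Ψ (a n)) ≤ 2 * x₀ / Ψ (8 * a n) * (Ψ (a n) + Ψ (a n)) := by
          gcongr
          · exact min_le_right _ _
          · exact hapos n
      _ = 4 * x₀ * (Ψ (a n) / Ψ (8 * a n)) := by ring
      _ ≤ 4 * x₀ * (1 / ((n : ℝ≥0) + 1)) := by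
          gcongr 4 * x₀ * ?_
          rw [div_le_div_iff₀ (hBpos' n) (by positivity), one_mul, mul_comm]
          exact (hB n).le
  have hplim : Tendsto (fun n => ((p n * (1 + Ψ (a n)) : ℝ≥0) : ℝ)) atTop (𝓝 0) := by
    refine squeeze_zero (fun n => NNReal.coe_nonneg _) (fun n => NNReal.coe_le_coe.2 (hp2 n)) ?_
    push_cast
    simpa using (tendsto_one_div_add_atTop_nhds_zero_nat (𝕜 := ℝ)).const_mul (4 * (x₀ : ℝ))
  let A : ℕ → Set Ω := fun n => {ω | U ω ≤ p n}
  have hAm : ∀ n, MeasurableSet (A n) := fun n => measurableSet_le hU measurable_const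
  have hAP : ∀ n, P (A n) = p n := fun n => by
    rw [hU2 _ ⟨NNReal.coe_nonneg _, by exact_mod_cast hp1 n⟩, ENNReal.ofReal_coe_nnreal]
  let f : ℕ → Ω → ℝ := fun n => (A n).indicator fun _ => -(a n : ℝ)
  have hfm : ∀ n, Measurable (f n) := fun n => measurable_const.indicator (hAm n)
  have hfmem : ∀ n, ∀ c : ℝ≥0, ∫⁻ ω, (Ψ (c * ‖f n ω‖₊) : ℝ≥0∞) ∂P < ∞ := by
    intro n c
    refine lt_of_le_of_lt (lintegral_mono (g := fun _ => (Ψ (c * a n) : ℝ≥0∞)) fun ω => ?_)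
      (by simp)
    rw [ENNReal.coe_le_coe]
    refine Ψ.monotone' (mul_le_mul_right ?_ c)
    by_cases hωA : ω ∈ A n <;> simp [f, hωA]
  let X : ℕ → orliczHeart Ψ P := fun n => ⟨_, mk_mem_orliczHeart (hfm n) (hfmem n)⟩
  have hX : ∀ n, (X n : Ω →ₘ[P] ℝ) =ᵐ[P] f n := fun n => AEEqFun.coeFn_mk _ _
  have hint : ∀ (Y : orliczHeart Ψ P) (g : ℝ → ℝ), Continuous g →
      ∫ x, g x ∂((rvLaw (Y : Ω →ₘ[P] ℝ) : ProbabilityMeasure ℝ) : Measure ℝ) =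
        ∫ ω, g ((Y : Ω →ₘ[P] ℝ) ω) ∂P := fun Y g hg =>
    integral_map (Y : Ω →ₘ[P] ℝ).measurable.aemeasurable hg.aestronglyMeasurable
  have hlim : Tendsto (fun n => (⟨rvLaw (X n : Ω →ₘ[P] ℝ), X n, rfl⟩ : heartLaws Ψ P)) atTop
      (@nhds _ (heartLawsTopology Ψ P)
        ⟨rvLaw ((0 : orliczHeart Ψ P) : Ω →ₘ[P] ℝ), 0, rfl⟩) := by
    refine tendsto_heartLaws fun g hg => ?_
    obtain ⟨hgc, C, hC⟩ := hg
    simp only [hint _ g hgc]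
    have h0 : ∫ ω, g (((0 : orliczHeart Ψ P) : Ω →ₘ[P] ℝ) ω) ∂P = g 0 := by
      have h : (fun ω => g (((0 : orliczHeart Ψ P) : Ω →ₘ[P] ℝ) ω)) =ᵐ[P] fun _ => g 0 := by
        filter_upwards [AEEqFun.coeFn_zero (μ := P) (α := Ω) (β := ℝ)] with ω hω
        rw [Submodule.coe_zero, hω, Pi.zero_apply]
      rw [integral_congr_ae h]
      simp
    have hn : ∀ n, ∫ ω, g ((X n : Ω →ₘ[P] ℝ) ω) ∂P = g 0 + p n * (g (-a n) - g 0) := by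
      intro n
      have h : (fun ω => g ((X n : Ω →ₘ[P] ℝ) ω)) =ᵐ[P]
          fun ω => g 0 + (A n).indicator (fun _ => g (-a n) - g 0) ω := by
        filter_upwards [hX n] with ω hω
        rw [hω]
        by_cases hωA : ω ∈ A n <;> simp [f, hωA]
      rw [integral_congr_ae h, integral_add (integrable_const _)
        ((integrable_const _).indicator (hAm n)), integral_indicator_const _ (hAm n)]
      simp [measureReal_def, hAP]
    rw [h0]
    simp only [hn]
    -- A test function is bounded by `C * (1 + Ψ (a n))` at `-a n`, so the perturbation is
    -- controlled by `p n * (1 + Ψ (a n))`.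
    have hbound : Tendsto (fun n => (p n : ℝ) * (g (-a n) - g 0)) atTop (𝓝 0) := by
      refine squeeze_zero_norm (a := fun n => ((p n * (1 + Ψ (a n)) : ℝ≥0) : ℝ) * (C + |g 0|))
        (fun n => ?_) (by simpa using hplim.mul_const (C + |g 0|))
      have h1 := hC (-a n)
      have hga : Ψ.gauge (-a n) = Ψ (a n) := by simp [FiniteYoungFunction.gauge]
      have hpos : (0 : ℝ) < 1 + Ψ (a n) := by positivity
      rw [hga, abs_div, abs_of_pos hpos, div_le_iff₀ hpos] at h1
      have h2 : |g 0| ≤ |g 0| * (1 + Ψ (a n)) :=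
        le_mul_of_one_le_right (abs_nonneg _) (by linarith [NNReal.coe_nonneg (Ψ (a n))])
      rw [norm_mul, Real.norm_eq_abs, Real.norm_eq_abs, abs_of_nonneg (NNReal.coe_nonneg _)]
      push_cast
      rw [mul_assoc]
      refine mul_le_mul_of_nonneg_left ?_ (NNReal.coe_nonneg _)
      refine (abs_sub _ _).trans ?_
      linarith
    simpa using hbound.const_add (g 0)
  have hR := (@Continuous.tendsto _ _ (heartLawsTopology Ψ P) _ _ hcont _).comp hlim
  simp only [Function.comp_def, riskFunctional_law hρ] at hR
  -- As the loss is continuous and vanishes at `0`, a small positive amount `δ` can be withdrawn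
  -- from the position `0` while keeping it acceptable.
  have hneg : shortfallRisk Ψ P (Ψ.loss 8) x₀ 0 < 0 := by
    have h1 : ∀ᶠ δ in 𝓝[>] (0 : ℝ), Ψ.loss 8 δ < x₀ :=
      (((Ψ.continuous_loss 8).tendsto 0).eventually
        (gt_mem_nhds (by rwa [Ψ.loss_of_nonpos 8 le_rfl]))).filter_mono nhdsWithin_le_nhds
    obtain ⟨δ, hδ, hδ0⟩ := (h1.and self_mem_nhdsWithin).exists
    have hδ0 : 0 < δ := hδ0
    refine (csInf_le (acceptableCash_bddBelow (by norm_num) x₀ _) (?_ : -δ ∈ _)).trans_lt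
      (neg_lt_zero.2 hδ0)
    have h : (fun ω => (Ψ.loss 8 (-((0 : orliczHeart Ψ P) : Ω →ₘ[P] ℝ) ω - -δ) : ℝ≥0∞)) =ᵐ[P]
        fun _ => (Ψ.loss 8 δ : ℝ≥0∞) := by
      filter_upwards [AEEqFun.coeFn_zero (μ := P) (α := Ω) (β := ℝ)] with ω hω
      rw [Submodule.coe_zero, hω, Pi.zero_apply]
      simp
    rw [mem_acceptableCash, lintegral_congr_ae h]
    simpa using hδ.le
  -- For negative cash the loss on `A n` is at least `Ψ (8 * a n)`, so its expectation is at least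
  -- `2 * x₀ > x₀`.
  have hnonneg : ∀ᶠ n : ℕ in atTop, 0 ≤ shortfallRisk Ψ P (Ψ.loss 8) x₀ (X n) := by
    obtain ⟨N, hN⟩ := exists_nat_ge (2 * x₀)
    filter_upwards [eventually_ge_atTop N] with n hn
    refine le_csInf (acceptableCash_nonempty 8 hx₀ _) fun m hm => ?_
    rw [mem_acceptableCash] at hm
    by_contra! hlt
    have hpn : p n * Ψ (8 * a n) = 2 * x₀ := by
      have h1 : 2 * x₀ / Ψ (8 * a n) ≤ 1 := by
        rw [div_le_one (hBpos' n)]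
        exact (hN.trans ((Nat.cast_le.2 hn).trans le_self_add)).trans (hBpos n).le
      simp only [p]
      rw [min_eq_right h1, div_mul_cancel₀ _ (hBpos' n).ne']
    have h2 : ((2 * x₀ : ℝ≥0) : ℝ≥0∞) ≤
        ∫⁻ ω, (Ψ.loss 8 (-(X n : Ω →ₘ[P] ℝ) ω - m) : ℝ≥0∞) ∂P := by
      calc ((2 * x₀ : ℝ≥0) : ℝ≥0∞)
          = ∫⁻ ω, (A n).indicator (fun _ => (Ψ (8 * a n) : ℝ≥0∞)) ω ∂P := by
            rw [lintegral_indicator_const (hAm n), hAP, ← hpn, mul_comm, ENNReal.coe_mul]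
        _ ≤ _ := by
            refine lintegral_mono_ae ?_
            filter_upwards [hX n] with ω hω
            by_cases hωA : ω ∈ A n
            · rw [indicator_of_mem hωA, ENNReal.coe_le_coe, hω]
              refine Ψ.monotone' (mul_le_mul_right ?_ 8)
              simp only [f, indicator_of_mem hωA]
              refine NNReal.coe_le_coe.1 (le_trans ?_ (Real.le_coe_toNNReal _))
              linarith
            · rw [indicator_of_notMem hωA]
              exact bot_le
    have h3 := h2.trans hm
    rw [ENNReal.coe_le_coe] at h3
    have h4 : x₀ < 2 * x₀ := by rw [two_mul]; exact lt_add_of_pos_right _ hx₀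
    exact h4.not_ge h3
  exact (ge_of_tendsto hR hnonneg).not_gt hneg

theorem mainTheorem8 {Ω : Type*} [MeasurableSpace Ω] (P : Measure Ω) [IsProbabilityMeasure P]
    (hP : IsAtomless P) (Ψ : FiniteYoungFunction) :
    ((∀ ρ : orliczHeart Ψ P → ℝ, IsLawInvariantConvexRiskMeasure ρ →
        Continuous[heartLawsTopology Ψ P, inferInstance] (riskFunctional ρ)) ↔ Ψ.Delta2) ∧
    (¬ Ψ.Delta2 → ∀ x₀ : ℝ≥0, 0 < x₀ →
      (∀ X : orliczHeart Ψ P, (acceptableCash (Ψ.loss 8) x₀ (X : Ω →ₘ[P] ℝ)).Nonempty ∧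
        BddBelow (acceptableCash (Ψ.loss 8) x₀ (X : Ω →ₘ[P] ℝ))) ∧
      IsLawInvariantConvexRiskMeasure (shortfallRisk Ψ P (Ψ.loss 8) x₀) ∧
      ¬ Continuous[heartLawsTopology Ψ P, inferInstance]
          (riskFunctional (shortfallRisk Ψ P (Ψ.loss 8) x₀))) := by
  have h8 : (0 : ℝ≥0) < 8 := by norm_num
  refine ⟨⟨fun h => ?_, fun hΨ ρ hρ => hρ.continuous_riskFunctional hP hΨ⟩, fun hΨ x₀ hx₀ =>
    ⟨fun X => ⟨acceptableCash_nonempty 8 hx₀ X, acceptableCash_bddBelow h8 x₀ _⟩,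
      isLawInvariantConvexRiskMeasure_shortfallRisk h8 hx₀,
      not_continuous_riskFunctional_shortfallRisk hP hΨ hx₀⟩⟩
  -- Any positive threshold gives a counterexample; `1` is used.
  by_contra hΨ
  exact not_continuous_riskFunctional_shortfallRisk hP hΨ one_pos
    (h _ (isLawInvariantConvexRiskMeasure_shortfallRisk h8 one_pos))
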